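/- Let $M^5\subset\mathbb C^4$ be a real-analytic (embedded, local) submanifold of real dimension $5$ with $0\in M$ which is CR-generic, i.e. $T_pM+\sqrt{-1}\,T_pM=T_p\mathbb C^4$ for every $p\in M$ (so that $T^{1,0}M$ has complex rank $1$). Assume that for every local real-analytic generator $\mathcal L$ of $T^{1,0}M$ the five complex vector fields $$\mathcal L,\quad \overline{\mathcal L},\quad [\mathcal L,\overline{\mathcal L}],\quad [\mathcal L,[\mathcal L,\overline{\mathcal L}]],\quad [\overline{\mathcal L},[\mathcal L,\overline{\mathcal L}]]$$ constitute a frame for $\mathbb C\otimes_{\mathbb R}TM$. Then there exist local holomorphic coordinates $(z,w_1,w_2,w_3)$ on $\mathbb C^4$ near $0$, vanishing at $0$, such that, writing $w_j=u_j+\sqrt{-1}\,v_j$, the submanifold $M$ is given near $0$ by three real-analytic graphed equations $v_j=\varphi_j(z,\bar z,u_1,u_2,u_3)$, $j=1,2,3$, of the form $$\begin{aligned} v_1&=z\bar z+z\bar z\,O_2(z,\bar z)+z\bar z\,O_1(u_1)+z\bar z\,O_1(u_2)+z\bar z\,O_1(u_3),\\ v_2&=z^2\bar z+z\bar z^2+z\bar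 z\,O_2(z,\bar z)+z\bar z\,O_1(u_1)+z\bar z\,O_1(u_2)+z\bar z\,O_1(u_3),\\ v_3&=\sqrt{-1}\,(z^2\bar z-z\bar z^2)+z\bar z\,O_2(z,\bar z)+z\bar z\,O_1(u_1)+z\bar z\,O_1(u_2)+z\bar z\,O_1(u_3). \end{aligned}$$ Here each $O_2(z,\bar z)$ denotes a real-valued real-analytic function of $z$ alone near $0$ that is $O(|z|^2)$ as $z\to0$, and each $O_1(u_l)$ denotes $u_l$ times a real-valued real-analytic function of $(z,u_1,u_2,u_3)$ near $0$. (The remainders differ from one equation to another.) -/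

import Mathlib

namespace CRGeometry

open Complex Set Filter Topology Asymptotics

variable {n : ℕ}

/-! ### Complexified tangent vectors of `ℂⁿ`

An element `(a, b)` of `CVec n` stands for the complexified tangent vector
`∑ k, a k ∂/∂z_k + ∑ k, b k ∂/∂z̄_k` of `ℂⁿ`, so that `CVec n`, with its usual structure of a
complex vector space, is `ℂ ⊗_ℝ T_p ℂⁿ`. A real tangent vector, that is a direction
`c : Fin n → ℂ`, corresponds to `(c, c̄)`. -/

/-- The complexified tangent space of `ℂⁿ` at a point. -/
abbrev CVec (n : ℕ) : Type := (Fin n → ℂ) × (Fin n → ℂ)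

/-- Complex conjugation on the complexified tangent space. -/
def conjVec (v : CVec n) : CVec n := (star v.2, star v.1)

/-- The real part of a complexified tangent vector, as a direction in `ℂⁿ`. -/
noncomputable def rePart (v : CVec n) : Fin n → ℂ := (1 / 2 : ℂ) • (v.1 + star v.2)

/-- The imaginary part of a complexified tangent vector, as a direction in `ℂⁿ`. -/
noncomputable def imPart (v : CVec n) : Fin n → ℂ := (1 / (2 * I) : ℂ) • (v.1 - star v.2)

/-- A complexified tangent vector is `X + i Y`, where `X` and `Y` are the real tangent vectors
given by its real and imaginary parts. -/
theorem rePart_add_I_smul_imPart (v : CVec n) :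
    ((rePart v, star (rePart v)) : CVec n) + I • ((imPart v, star (imPart v)) : CVec n) = v := by
  have hI : I ≠ 0 := I_ne_zero
  ext k
  · simp only [rePart, imPart, Prod.fst_add, Prod.smul_fst, Pi.add_apply, Pi.smul_apply,
      Pi.sub_apply, Pi.star_apply, smul_eq_mul]
    field_simp
    ring
  · simp only [rePart, imPart, Prod.snd_add, Prod.smul_snd, Pi.add_apply, Pi.smul_apply,
      Pi.sub_apply, Pi.star_apply, smul_eq_mul, star_mul', star_add, star_sub, star_star]
    simp
    field_simp
    ring_nf
    simp
    ring

/-! ### Complex vector fields and their brackets -/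

/-- The derivative of `f` at `p` along the complexified tangent vector `v = X + i Y`, that is
`df_p(X) + i df_p(Y)`. -/
noncomputable def derivAlong {F : Type*} [NormedAddCommGroup F] [NormedSpace ℂ F]
    (f : (Fin n → ℂ) → F) (p : Fin n → ℂ) (v : CVec n) : F :=
  fderiv ℝ f p (rePart v) + I • fderiv ℝ f p (imPart v)

/-- The Lie bracket `[X, Y]` of two complex vector fields: its coefficients are
`X(coefficients of Y) - Y(coefficients of X)`. -/
noncomputable def bracket (X Y : (Fin n → ℂ) → CVec n) : (Fin n → ℂ) → CVec n :=
  fun p => derivAlong Y p (X p) - derivAlong X p (Y p)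

/-- The conjugate of a complex vector field. -/
def conjField (X : (Fin n → ℂ) → CVec n) : (Fin n → ℂ) → CVec n := fun p => conjVec (X p)

/-! ### Real analytic CR-generic submanifolds -/

/-- `M` is an (embedded) real analytic submanifold of `ℂⁿ` of real codimension `c`, hence of real
dimension `2 n - c`. -/
def IsAnalyticSubmanifold (c : ℕ) (M : Set (Fin n → ℂ)) : Prop :=
  ∀ p ∈ M, ∃ U : Set (Fin n → ℂ), IsOpen U ∧ p ∈ U ∧
    ∃ ρ : (Fin n → ℂ) → (Fin c → ℝ), AnalyticOnNhd ℝ ρ U ∧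
      (∀ q ∈ U, Function.Surjective (fderiv ℝ ρ q)) ∧ M ∩ U = {q ∈ U | ρ q = 0}

/-- The real tangent space `T_p M`, as the set of velocities of the curves drawn in `M` through
`p`. -/
def tangentVectors (M : Set (Fin n → ℂ)) (p : Fin n → ℂ) : Set (Fin n → ℂ) :=
  {v | ∃ γ : ℝ → (Fin n → ℂ), γ 0 = p ∧ (∀ᶠ t in 𝓝 (0 : ℝ), γ t ∈ M) ∧ HasDerivAt γ v 0}

/-- `M` is CR-generic: `T_p M + i T_p M = T_p ℂⁿ` at every point `p` of `M`. -/
def IsCRGeneric (M : Set (Fin n → ℂ)) : Prop :=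
  ∀ p ∈ M, ∀ v : Fin n → ℂ,
    ∃ a ∈ tangentVectors M p, ∃ b ∈ tangentVectors M p, v = a + I • b

/-- The fibre at `p` of `ℂ ⊗_ℝ TM`. -/
def complexTangent (M : Set (Fin n → ℂ)) (p : Fin n → ℂ) : Set (CVec n) :=
  {v | rePart v ∈ tangentVectors M p ∧ imPart v ∈ tangentVectors M p}

/-- The fibre at `p` of `T^{1,0}M`: the vectors of `ℂ ⊗_ℝ T_p M` without `∂/∂z̄_k` terms. -/
def holTangent (M : Set (Fin n → ℂ)) (p : Fin n → ℂ) : Set (CVec n) :=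
  {v | v ∈ complexTangent M p ∧ v.2 = 0}

/-- `L` is a real analytic generator of `T^{1,0}M` on `M ∩ U` (for `M` of CR dimension `1`).
As usual `L` is given by an extension to the open subset `U` of `ℂⁿ`; since `L` and its conjugate
are tangent to `M` along `M`, their iterated brackets at the points of `M ∩ U` do not depend on
the extension. -/
def IsLocalGenerator (M U : Set (Fin n → ℂ)) (L : (Fin n → ℂ) → CVec n) : Prop :=
  IsOpen U ∧ AnalyticOnNhd ℝ L U ∧
    ∀ p ∈ M ∩ U, L p ≠ 0 ∧ (Submodule.span ℂ {L p} : Set (CVec n)) = holTangent M p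

/-- The five complex vector fields
`L`, `L̄`, `[L, L̄]`, `[L, [L, L̄]]`, `[L̄, [L, L̄]]`. -/
noncomputable def fiveFields (L : (Fin n → ℂ) → CVec n) : Fin 5 → (Fin n → ℂ) → CVec n :=
  ![L, conjField L, bracket L (conjField L), bracket L (bracket L (conjField L)),
    bracket (conjField L) (bracket L (conjField L))]

/-- For every local generator `L` of `T^{1,0}M`, the five fields
`L`, `L̄`, `[L, L̄]`, `[L, [L, L̄]]`, `[L̄, [L, L̄]]` are a frame for `ℂ ⊗_ℝ TM`. -/
def FrameCondition (M : Set (Fin n → ℂ)) : Prop :=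
  ∀ (U : Set (Fin n → ℂ)) (L : (Fin n → ℂ) → CVec n), IsLocalGenerator M U L →
    ∀ p ∈ M ∩ U, LinearIndependent ℂ (fun i => fiveFields L i p) ∧
      (Submodule.span ℂ (range fun i => fiveFields L i p) : Set (CVec n)) = complexTangent M p

/-- The general class III₁: real analytic CR-generic submanifolds `M⁵ ⊂ ℂ⁴` such that
`{L, L̄, [L, L̄], [L, [L, L̄]], [L̄, [L, L̄]]}` is a frame for `ℂ ⊗_ℝ TM`. -/
def IsGeneralClassIIIOne (M : Set (Fin 4 → ℂ)) : Prop :=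
  IsAnalyticSubmanifold 3 M ∧ IsCRGeneric M ∧ FrameCondition M

/-! ### The normal form -/

/-- The leading terms `z z̄`, `z² z̄ + z z̄²`, `i (z² z̄ - z z̄²)`. -/
noncomputable def leadingTerm (z : ℂ) : Fin 3 → ℂ :=
  ![z * star z, z ^ 2 * star z + z * star z ^ 2, I * (z ^ 2 * star z - z * star z ^ 2)]

/-- `φ` is a triple of real analytic graphing functions on `{|z| < r, |u_l| < r}` whose `j`-th
component is the `j`-th leading term plus a remainder
`z z̄ O_2(z, z̄) + z z̄ O_1(u_1) + z z̄ O_1(u_2) + z z̄ O_1(u_3)`: here `O_2(z, z̄)` is a real analytic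
function of `z` alone vanishing to order two at `0`, and `O_1(u_l)` is `u_l` times a real
analytic function of `(z, u_1, u_2, u_3)`. -/
def IsNormalizedGraph (r : ℝ) (φ : Fin 3 → ℂ × (Fin 3 → ℝ) → ℝ) : Prop :=
  (∀ j, AnalyticOnNhd ℝ (φ j) (Metric.ball 0 r)) ∧
  ∃ (R : Fin 3 → ℂ → ℝ) (S : Fin 3 → Fin 3 → ℂ × (Fin 3 → ℝ) → ℝ),
    (∀ j, AnalyticOnNhd ℝ (R j) (Metric.ball 0 r)) ∧
    (∀ j, (R j) =O[𝓝 0] fun z => ‖z‖ ^ 2) ∧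
    (∀ j l, AnalyticOnNhd ℝ (S j l) (Metric.ball 0 r)) ∧
    ∀ z : ℂ, ∀ u : Fin 3 → ℝ, (z, u) ∈ Metric.ball (0 : ℂ × (Fin 3 → ℝ)) r →
      ∀ j, (φ j (z, u) : ℂ) =
        leadingTerm z j + z * star z * (R j z : ℂ) + ∑ l, z * star z * ((u l * S j l (z, u) : ℝ) : ℂ)

end CRGeometry

/-! The idea is to treat `z̄, w̄` as independent variables `ζ, τ`, put `M` in normal coordinates by
solving holomorphic equations, and read the frame condition as a statement about a first-order jet
at the origin.

Genericity gives linear coordinates `(z, w)` in which `T_0 M` is `Im w = 0`. The real defining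
functions extend holomorphically to `r((z, w), (ζ, τ))`, with linear part `(w - τ)/(2i)` at `0`, so
`r = 0` can be solved as `w = Q(z, ζ, τ)` (`exists_complexified_defining_function`,
`exists_analyticAt_implicit`). The change of coordinates `(z, s) ↦ (z, Q(z, 0, s - i h(s)))`, where
`w = s + i h(s)` is the part of `M` over `z = 0`, straightens the Segre varieties of the points with
`z = 0` (`exists_normal_coordinates`). Afterwards the solved equation reduces to `s = τ` both when
`z = 0` and when `ζ = 0`. Dividing convergent power series twice then gives `s = τ + zζ q(z, ζ, τ)`
(`exists_complex_graph`, resting on `exists_analyticAt_smul_eq_sub`). Passing to real and imaginary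
parts turns this into `Im s = z z̄ ψ(z, z̄, Re s)`, where `ψ` has the 1-jet of `q/(2i)` at `0`
(`exists_real_graph`).

In these coordinates `L = ∂_z + z̄ κ ∂_s` generates `T^{1,0}M`, with `κ = q + z q_z`. At the origin
the five fields send the functions `s` to `0`, `0`, `-κ`, `-Lκ`, `-2 L̄κ`, all of which lie in the
span of `q(0)`, `q_z(0)`, `q_ζ(0)` (`derivAlong_fiveFields`). The fields span `ℂ ⊗ T_0 M`, which
genericity maps onto `ℂ³` under `ds`. Hence these three vectors span `ℂ³`
(`span_eq_top_of_frameCondition`).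

Reality of `ψ` turns this into a real basis of `ℝ³`: the value of `ψ(z, z̄, u)` at `0` and its
derivatives along the directions `1` and `i` of `z`. A real linear map `B` brings that jet to the
one of `(1, z + z̄, i(z - z̄))`. It acts on `w` through its complexification and therefore preserves
the form of the graph. What remains is a Taylor remainder in `z` and Hadamard quotients in `u`
(`exists_isNormalizedGraph`). -/

namespace CRGeometry

open Complex Set Filter Topology Asymptotics

/-! ### Analytic tools: division, complexification, implicit functions -/

/-- A formal multilinear series whose coefficients grow at most geometrically relative to a series
of positive radius has positive radius. -/
theorem radius_pos_of_norm_le {𝕜 𝕜' E F E' F' : Type*} [NontriviallyNormedField 𝕜]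
    [NontriviallyNormedField 𝕜'] [NormedAddCommGroup E] [NormedSpace 𝕜 E] [NormedAddCommGroup F]
    [NormedSpace 𝕜 F] [NormedAddCommGroup E'] [NormedSpace 𝕜' E'] [NormedAddCommGroup F']
    [NormedSpace 𝕜' F'] {p : FormalMultilinearSeries 𝕜 E F} (hp : 0 < p.radius)
    (q : FormalMultilinearSeries 𝕜' E' F') (C K : ℝ) (hC : 0 < C) (hK : 0 ≤ K) (m : ℕ)
    (h : ∀ n, ‖q n‖ ≤ K * C ^ n * ‖p (n + m)‖) : 0 < q.radius := by
  obtain ⟨r, hr0, hr⟩ := ENNReal.lt_iff_exists_nnreal_btwn.1 hp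
  have hr0' : 0 < (r : ℝ) := by exact_mod_cast hr0
  obtain ⟨A, hA, hpA⟩ := p.norm_le_div_pow_of_pos_of_lt_radius hr0' hr
  -- Shrinking the radius by `C` absorbs the geometric factor; the index shift `m` only costs the
  -- constant `r ^ m`.
  have hs : 0 < (r : ℝ) / C := by positivity
  obtain ⟨t, ht⟩ : ∃ t : NNReal, (t : ℝ) = (r : ℝ) / C := ⟨⟨_, hs.le⟩, rfl⟩
  have : (t : ENNReal) ≤ q.radius := by
    refine q.le_radius_of_bound (K * (A / (r : ℝ) ^ m)) fun n => ?_
    have h1 := (h n).trans (mul_le_mul_of_nonneg_left (hpA (n + m)) (by positivity))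
    refine (mul_le_mul_of_nonneg_right h1 (by positivity)).trans (le_of_eq ?_)
    rw [ht]
    simp only [div_pow, pow_add]
    field_simp
  refine lt_of_lt_of_le ?_ this
  have : 0 < (t : ℝ) := ht ▸ hs
  exact_mod_cast this

/-- The difference of an analytic function and its composition with the projection
`x ↦ x - ℓ x • e` is divisible by `ℓ`. -/
theorem exists_analyticAt_smul_eq_sub {𝕜 E F : Type*} [NontriviallyNormedField 𝕜]
    [NormedAddCommGroup E] [NormedSpace 𝕜 E] [NormedAddCommGroup F] [NormedSpace 𝕜 F]
    [CompleteSpace F] {f : E → F} (hf : AnalyticAt 𝕜 f 0) (ℓ : E →L[𝕜] 𝕜) (e : E) :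
    ∃ g : E → F, AnalyticAt 𝕜 g 0 ∧ ∀ᶠ x in 𝓝 0, f x - f (x - ℓ x • e) = ℓ x • g x := by
  obtain ⟨p, hp⟩ := hf
  set π : E →L[𝕜] E := ContinuousLinearMap.id 𝕜 E - ℓ.smulRight e with hπ
  have hπx : ∀ x, π x = x - ℓ x • e := fun x => by simp [hπ]
  -- Telescoping: turn `p (n + 1) (πx, …, πx)` into `p (n + 1) (x, …, x)` one slot at a time.
  -- Changing slot `k` contributes a term with `x - πx = ℓ x • e` in that slot, `x` before it and
  -- `πx` after it, so `ℓ x` factors out.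
  let q : FormalMultilinearSeries 𝕜 E F := fun n =>
    ∑ k : Fin (n + 1), ((p (n + 1)).curryMid k e).compContinuousLinearMap
      (fun i => if (k.succAbove i) < k then ContinuousLinearMap.id 𝕜 E else π)
  set C : ℝ := max 1 ‖π‖ with hC
  have hC1 : 1 ≤ C := le_max_left _ _
  have hq : ∀ n, ‖q n‖ ≤ ‖e‖ * (2 * C) ^ n * ‖p (n + 1)‖ := by
    intro n
    have : ∀ k ∈ (Finset.univ : Finset (Fin (n + 1))),
        ‖((p (n + 1)).curryMid k e).compContinuousLinearMap
        (fun i => if (k.succAbove i) < k then ContinuousLinearMap.id 𝕜 E else π)‖ ≤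
        ‖p (n + 1)‖ * ‖e‖ * C ^ n := by
      intro k _
      refine (ContinuousMultilinearMap.norm_compContinuousLinearMap_le _ _).trans ?_
      refine mul_le_mul ?_ ?_ (Finset.prod_nonneg fun _ _ => norm_nonneg _) (by positivity)
      · refine (ContinuousLinearMap.le_opNorm _ _).trans ?_
        rw [ContinuousMultilinearMap.norm_curryMid]
      · refine (Finset.prod_le_prod (fun _ _ => norm_nonneg _) fun i _ => ?_).trans
          (Finset.prod_const C).le |>.trans (by simp)
        split_ifs
        · exact ContinuousLinearMap.norm_id_le.trans hC1
        · exact le_max_right _ _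
    refine (norm_sum_le_of_le _ this).trans ?_
    rw [Finset.sum_const, Finset.card_univ, Fintype.card_fin, nsmul_eq_mul, mul_pow]
    have h2 : ((n + 1 : ℕ) : ℝ) ≤ 2 ^ n := by exact_mod_cast Nat.lt_two_pow_self
    calc ((n + 1 : ℕ) : ℝ) * (‖p (n + 1)‖ * ‖e‖ * C ^ n)
        ≤ 2 ^ n * (‖p (n + 1)‖ * ‖e‖ * C ^ n) := by gcongr
      _ = _ := by ring
  have hrad : 0 < q.radius :=
    radius_pos_of_norm_le hp.radius_pos q (2 * C) ‖e‖ (by positivity) (norm_nonneg _) 1 hq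
  have hqs := q.hasFPowerSeriesOnBall hrad
  have key : ∀ (n : ℕ) (x : E), ℓ x • q n (fun _ => x) =
      p (n + 1) (fun _ => x) - p (n + 1) (fun _ => π x) := by
    intro n x
    let T : ℕ → F := fun k => p (n + 1) (fun i => if (i : ℕ) < k then x else π x)
    have h1 : p (n + 1) (fun _ => x) - p (n + 1) (fun _ => π x) = T (n + 1) - T 0 := by
      simp only [T, Fin.is_lt, if_true, Nat.not_lt_zero, if_false]
    have h2 : ℓ x • q n (fun _ => x) = ∑ k : Fin (n + 1), (T (k + 1) - T k) := by
      simp only [q, _root_.sum_apply, Finset.smul_sum]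
      refine Finset.sum_congr rfl fun k _ => ?_
      have h3 : ∀ y : E, p (n + 1) (Function.update
          (fun i : Fin (n + 1) => if (i : ℕ) < k then x else π x) k y) =
          (p (n + 1)).curryMid k y (fun i => if k.succAbove i < k then x else π x) := by
        intro y
        rw [ContinuousMultilinearMap.curryMid_apply]
        congr 1
        ext i
        refine Fin.succAboveCases k ?_ (fun j => ?_) i
        · simp
        · simp
      have h4 : T (k + 1) = p (n + 1) (Function.update
          (fun i : Fin (n + 1) => if (i : ℕ) < k then x else π x) k x) := by
        simp only [T]
        congr 1
        ext i
        rcases eq_or_ne i k with rfl | hik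
        · simp
        · have : (i : ℕ) ≠ k := fun h => hik (Fin.ext h)
          rw [Function.update_of_ne hik]
          exact if_congr (by omega) rfl rfl
      have h5 : T k = p (n + 1) (Function.update
          (fun i : Fin (n + 1) => if (i : ℕ) < k then x else π x) k (π x)) := by
        simp only [T]
        congr 1
        ext i
        rcases eq_or_ne i k with rfl | hik
        · simp
        · rw [Function.update_of_ne hik]
      rw [h4, h5, h3, h3, ← _root_.sub_apply, ← map_sub, hπx, sub_sub_cancel,
        map_smul, _root_.smul_apply,
        ContinuousMultilinearMap.compContinuousLinearMap_apply]
      congr 2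
      ext i
      split_ifs <;> rfl
    rw [h1, h2, Fin.sum_univ_eq_sum_range (fun k => T (k + 1) - T k) (n + 1),
      Finset.sum_range_sub]
  refine ⟨q.sum, hqs.analyticAt, ?_⟩
  have hpe := hp.eventually_hasSum
  have hπ0 : Tendsto (fun x => π x) (𝓝 0) (𝓝 0) := by
    have := π.continuous.tendsto 0
    rwa [map_zero] at this
  filter_upwards [hpe, hπ0.eventually hpe, hqs.hasFPowerSeriesAt.eventually_hasSum]
    with x h1 h2 h3
  simp only [zero_add] at h1 h2 h3
  -- The degree-zero terms of the two expansions cancel, so the difference starts in degree one, in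
  -- step with the shifted index of `q`.
  have h4 := (hasSum_nat_add_iff' 1).2 (h1.sub h2)
  have h5 := h3.const_smul (ℓ x)
  simp only [key] at h5
  rw [← hπx]
  refine HasSum.unique ?_ h5
  convert h4 using 1
  have : p 0 (fun _ => x) = p 0 (fun _ => π x) := by
    congr 1; ext i; exact i.elim0
  simp [this]

/-- A real analytic function of several real variables extends to a holomorphic function, which
takes conjugate values at conjugate points. -/
theorem exists_complexification {ι : Type*} [Fintype ι] {f : (ι → ℝ) → ℝ}
    (hf : AnalyticAt ℝ f 0) :
    ∃ F : (ι → ℂ) → ℂ, AnalyticAt ℂ F 0 ∧ (∀ᶠ x : ι → ℝ in 𝓝 0, F (fun i => (x i : ℂ)) = f x) ∧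
      ∀ᶠ y in 𝓝 0, F (star y) = star (F y) := by
  classical
  obtain ⟨p, hp⟩ := hf
  -- The complexified series has the same real coefficients on monomials, now evaluated at complex
  -- variables.
  let c : ∀ n, (Fin n → ι) → ℝ := fun n r => p n (fun k => Pi.single (r k) 1)
  let q : FormalMultilinearSeries ℂ (ι → ℂ) ℂ := fun n =>
    ∑ r : Fin n → ι, (c n r : ℂ) • (ContinuousMultilinearMap.mkPiAlgebra ℂ (Fin n)
      ℂ).compContinuousLinearMap (fun k => ContinuousLinearMap.proj (r k))
  have hqa : ∀ n y, q n (fun _ => y) = ∑ r : Fin n → ι, (c n r : ℂ) * ∏ k, y (r k) := by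
    intro n y
    simp [q]
  have hc : ∀ n r, |c n r| ≤ ‖p n‖ := by
    intro n r
    refine ((p n).le_opNorm _).trans ?_
    refine mul_le_of_le_one_right (norm_nonneg _) (Finset.prod_le_one (fun _ _ => norm_nonneg _) ?_)
    intro k _
    rw [pi_norm_le_iff_of_nonneg zero_le_one]
    intro i
    by_cases h : i = r k
    · subst h; simp
    · simp [Pi.single_eq_of_ne h]
  -- There are `card ι ^ n` monomials; the extra `1` keeps the base positive when `ι` is empty.
  have hq : ∀ n, ‖q n‖ ≤ 1 * ((Fintype.card ι : ℝ) + 1) ^ n * ‖p (n + 0)‖ := by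
    intro n
    refine (norm_sum_le_of_le (n := fun _ => ‖p n‖) _ fun r _ => ?_).trans ?_
    · rw [norm_smul, Complex.norm_real]
      refine (mul_le_mul (hc n r) ?_ (norm_nonneg _) (norm_nonneg _)).trans (mul_one _).le
      refine ContinuousMultilinearMap.opNorm_le_bound zero_le_one fun m => ?_
      simp only [ContinuousMultilinearMap.compContinuousLinearMap_apply,
        ContinuousLinearMap.proj_apply, ContinuousMultilinearMap.mkPiAlgebra_apply, norm_prod,
        one_mul]
      exact Finset.prod_le_prod (fun _ _ => norm_nonneg _) fun k _ => norm_le_pi_norm _ _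
    · rw [Finset.sum_const, Finset.card_univ, nsmul_eq_mul, one_mul, add_zero]
      refine mul_le_mul_of_nonneg_right ?_ (norm_nonneg _)
      rw [Fintype.card_fun, Fintype.card_fin]
      push_cast
      gcongr
      linarith
  have hrad : 0 < q.radius :=
    radius_pos_of_norm_le hp.radius_pos q _ 1 (by positivity) zero_le_one 0 hq
  have hqs := q.hasFPowerSeriesOnBall hrad
  have hqe := hqs.hasFPowerSeriesAt.eventually_hasSum
  refine ⟨q.sum, hqs.analyticAt, ?_, ?_⟩
  · have h0 : Tendsto (fun (x : ι → ℝ) (i : ι) => (x i : ℂ)) (𝓝 0) (𝓝 0) := by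
      have : Continuous (fun (x : ι → ℝ) (i : ι) => (x i : ℂ)) := by fun_prop
      have := this.tendsto 0
      convert this using 2
      ext i; simp
    filter_upwards [h0.eventually hqe, hp.eventually_hasSum] with x h1 h2
    simp only [zero_add] at h1 h2
    refine h1.unique ?_
    refine (Complex.hasSum_ofReal.2 h2).congr_fun fun n => ?_
    rw [hqa]
    have hx : (fun _ : Fin n => x) = fun _ => ∑ i, x i • (Pi.single i (1 : ℝ) : ι → ℝ) := by
      ext k j
      simp [Finset.sum_apply, Pi.single_apply]
    rw [hx, ← ContinuousMultilinearMap.coe_coe, MultilinearMap.map_sum]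
    push_cast
    refine Finset.sum_congr rfl fun r _ => ?_
    rw [MultilinearMap.map_smul_univ]
    simp [c, mul_comm]
  · have h0 : Tendsto (fun y : ι → ℂ => star y) (𝓝 0) (𝓝 0) := by
      have := (continuous_star (R := ι → ℂ)).tendsto 0
      rwa [star_zero] at this
    filter_upwards [hqe, h0.eventually hqe] with y h1 h2
    simp only [zero_add] at h1 h2
    refine h2.unique ?_
    refine h1.star.congr_fun fun n => ?_
    rw [hqa, hqa, star_sum]
    refine Finset.sum_congr rfl fun r _ => ?_
    simp

/-- The analytic implicit function theorem at the origin. -/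
theorem exists_analyticAt_implicit {X Y : Type*} [NormedAddCommGroup X] [NormedSpace ℂ X]
    [CompleteSpace X] [NormedAddCommGroup Y] [NormedSpace ℂ Y] [CompleteSpace Y] {f : X × Y → Y}
    (hf : AnalyticAt ℂ f 0) (h0 : f 0 = 0) {c : ℂ} (hc : c ≠ 0)
    (hd : ∀ y, fderiv ℂ f 0 (0, y) = c • y) :
    ∃ g : X → Y, AnalyticAt ℂ g 0 ∧ g 0 = 0 ∧ (∀ᶠ v in 𝓝 (0 : X × Y), f v = 0 ↔ v.2 = g v.1) ∧
      ∀ x, c • fderiv ℂ g 0 x = - fderiv ℂ f 0 (x, 0) := by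
  -- In `WithTop ℕ∞` the top element is analyticity rather than `C^∞`, so the implicit function
  -- obtained is analytic.
  have hf' : ContDiffAt ℂ ⊤ f 0 := hf.contDiffAt
  have e1 : fderiv ℂ f 0 ∘L .inr ℂ X Y =
      (ContinuousLinearEquiv.smulLeft (Units.mk0 c hc) : Y ≃L[ℂ] Y) := by
    ext y
    simpa using! hd y
  have hi : (fderiv ℂ f 0 ∘L .inr ℂ X Y).IsInvertible := ⟨_, e1.symm⟩
  have hn : (⊤ : WithTop ℕ∞) ≠ 0 := by simp
  have hg : AnalyticAt ℂ (hf'.implicitFunction hn hi) 0 :=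
    ContDiffAt.analyticAt (hf'.contDiffAt_implicitFunction hn hi)
  have hg0 : hf'.implicitFunction hn hi 0 = 0 := hf'.implicitFunction_apply_self hn hi
  refine ⟨hf'.implicitFunction hn hi, hg, hg0, ?_, fun x => ?_⟩
  · filter_upwards [hf'.eventually_apply_eq_iff_implicitFunction hn hi] with v hv
    rw [h0] at hv
    rw [hv, eq_comm]
  · have h3 : fderiv ℂ f 0 (x, fderiv ℂ (hf'.implicitFunction hn hi) 0 x) = 0 := by
      have hev : ∀ᶠ x in 𝓝 (0 : X), f (x, hf'.implicitFunction hn hi x) = 0 := by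
        have := hf'.eventually_apply_implicitFunction hn hi
        rw [h0] at this; exact this
      have hcomp : HasFDerivAt (fun x => f (x, hf'.implicitFunction hn hi x))
          ((fderiv ℂ f 0).comp ((ContinuousLinearMap.id ℂ X).prod
            (fderiv ℂ (hf'.implicitFunction hn hi) 0))) 0 := by
        have hpair := (hasFDerivAt_id (𝕜 := ℂ) (0 : X)).prodMk
          hg.differentiableAt.hasFDerivAt
        have hf0 : HasFDerivAt f (fderiv ℂ f 0) ((id 0 : X), hf'.implicitFunction hn hi 0) := by
          rw [hg0]; exact hf.differentiableAt.hasFDerivAt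
        exact hf0.comp (0 : X) hpair
      have h4 := (hcomp.congr_of_eventuallyEq (f₁ := fun _ => (0 : Y))
        (hev.mono fun x hx => hx.symm)).unique (hasFDerivAt_const (0 : Y) (0 : X))
      simpa using! DFunLike.congr_fun h4 x
    have h5 : ((x, fderiv ℂ (hf'.implicitFunction hn hi) 0 x) : X × Y) =
      (x, 0) + (0, fderiv ℂ (hf'.implicitFunction hn hi) 0 x) := by simp
    rw [h5, map_add, hd] at h3
    exact eq_neg_of_add_eq_zero_right h3

end CRGeometry

/-! ### Calculus along complexified tangent vectors, and tangent spaces -/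

namespace CRGeometry

open Complex Set Filter Topology Asymptotics

/-- `rePart` as a continuous real linear map. -/
noncomputable def rePartL (n : ℕ) : CVec n →L[ℝ] (Fin n → ℂ) :=
  LinearMap.toContinuousLinearMap
    { toFun := rePart
      map_add' := fun v w => by
        simp only [rePart, Prod.fst_add, Prod.snd_add, star_add, ← smul_add]; congr 1; abel
      map_smul' := fun c v => by
        ext k; simp [rePart]; ring }

/-- `imPart` as a continuous real linear map. -/
noncomputable def imPartL (n : ℕ) : CVec n →L[ℝ] (Fin n → ℂ) :=
  LinearMap.toContinuousLinearMap
    { toFun := imPart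
      map_add' := fun v w => by
        simp only [imPart, Prod.fst_add, Prod.snd_add, star_add, ← smul_add]; congr 1; abel
      map_smul' := fun c v => by
        ext k; simp [imPart]; ring }

variable {n : ℕ} {F : Type*} [NormedAddCommGroup F] [NormedSpace ℂ F]

theorem rePartL_apply (v : CVec n) : rePartL n v = rePart v := rfl

theorem imPartL_apply (v : CVec n) : imPartL n v = imPart v := rfl

theorem rePart_I_smul (v : CVec n) : rePart (I • v) = -imPart v := by
  ext k; simp [rePart, imPart]; field_simp; ring

theorem imPart_I_smul (v : CVec n) : imPart (I • v) = rePart v := by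
  ext k; simp [rePart, imPart]; field_simp; ring_nf; simp only [I_sq]; ring

theorem rePart_add_smul_imPart (v : CVec n) : rePart v + I • imPart v = v.1 := by
  ext k; simp [rePart, imPart]; field_simp; ring_nf; simp only [I_sq]; ring

theorem rePart_sub_smul_imPart (v : CVec n) : rePart v - I • imPart v = star v.2 := by
  ext k; simp [rePart, imPart]; field_simp; ring_nf; simp only [I_sq]; ring

theorem derivAlong_add_right (f : (Fin n → ℂ) → F) (p : Fin n → ℂ) (v w : CVec n) :
    derivAlong f p (v + w) = derivAlong f p v + derivAlong f p w := by
  simp only [derivAlong, ← rePartL_apply, ← imPartL_apply, map_add, smul_add]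
  abel

theorem derivAlong_real_smul_right (f : (Fin n → ℂ) → F) (p : Fin n → ℂ) (c : ℝ) (v : CVec n) :
    derivAlong f p (c • v) = c • derivAlong f p v := by
  simp only [derivAlong, ← rePartL_apply, ← imPartL_apply, map_smul, smul_add]
  rw [smul_comm]

theorem derivAlong_I_smul_right (f : (Fin n → ℂ) → F) (p : Fin n → ℂ) (v : CVec n) :
    derivAlong f p (I • v) = I • derivAlong f p v := by
  simp only [derivAlong, rePart_I_smul, imPart_I_smul, map_neg, smul_add, smul_smul, I_mul_I,
    neg_smul, one_smul]
  abel

/-- `derivAlong f p` as a complex linear map. -/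
noncomputable def derivAlongL (f : (Fin n → ℂ) → F) (p : Fin n → ℂ) : CVec n →ₗ[ℂ] F where
  toFun := derivAlong f p
  map_add' := derivAlong_add_right f p
  map_smul' c v := by
    have hc : c • v = c.re • v + c.im • (I • v) := by
      conv_lhs => rw [← re_add_im c]
      rw [add_smul, mul_smul]
      rfl
    have hc' : ∀ x : F, c • x = c.re • x + c.im • (I • x) := fun x => by
      conv_lhs => rw [← re_add_im c]
      rw [add_smul, mul_smul]
      rfl
    rw [hc, derivAlong_add_right, derivAlong_real_smul_right, derivAlong_real_smul_right,
      derivAlong_I_smul_right]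
    exact (hc' _).symm

theorem derivAlongL_apply (f : (Fin n → ℂ) → F) (p : Fin n → ℂ) (v : CVec n) :
    derivAlongL f p v = derivAlong f p v := rfl

theorem derivAlong_congr {f g : (Fin n → ℂ) → F} {p : Fin n → ℂ} (h : f =ᶠ[𝓝 p] g)
    (v : CVec n) : derivAlong f p v = derivAlong g p v := by
  simp only [derivAlong, h.fderiv_eq]

theorem derivAlong_fun_zero (p : Fin n → ℂ) (v : CVec n) :
    derivAlong (fun _ => (0 : F)) p v = 0 := by
  simp [derivAlong]

theorem derivAlong_add {f g : (Fin n → ℂ) → F} {p : Fin n → ℂ} (hf : DifferentiableAt ℝ f p)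
    (hg : DifferentiableAt ℝ g p) (v : CVec n) :
    derivAlong (fun x => f x + g x) p v = derivAlong f p v + derivAlong g p v := by
  simp only [derivAlong, fderiv_fun_add hf hg, add_apply, smul_add]
  abel

theorem derivAlong_neg (f : (Fin n → ℂ) → F) (p : Fin n → ℂ) (v : CVec n) :
    derivAlong (fun x => - f x) p v = - derivAlong f p v := by
  simp only [derivAlong, fderiv_fun_neg, neg_apply, smul_neg]
  abel

theorem derivAlong_smul {a : (Fin n → ℂ) → ℂ} {k : (Fin n → ℂ) → F} {p : Fin n → ℂ}
    (ha : DifferentiableAt ℝ a p) (hk : DifferentiableAt ℝ k p) (v : CVec n) :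
    derivAlong (fun x => a x • k x) p v = derivAlong a p v • k p + a p • derivAlong k p v := by
  have h : fderiv ℝ (fun x => a x • k x) p = a p • fderiv ℝ k p + (fderiv ℝ a p).smulRight (k p) :=
    (ha.hasFDerivAt.smul hk.hasFDerivAt).fderiv
  simp only [derivAlong, h, add_apply, smul_apply, ContinuousLinearMap.smulRight_apply, smul_add,
    add_smul, smul_eq_mul, mul_smul]
  rw [smul_comm I (a p)]
  abel

/-- By complex linearity `g'(X) + i g'(Y) = g'(X + iY)`, and `X + iY` is the `(1,0)` part of `v`;
the `(0,1)` part is invisible to a holomorphic function. -/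
theorem derivAlong_of_hasFDerivAt {g : (Fin n → ℂ) → F} {g' : (Fin n → ℂ) →L[ℂ] F}
    {p : Fin n → ℂ} (hg : HasFDerivAt g g' p) (v : CVec n) : derivAlong g p v = g' v.1 := by
  have h : fderiv ℝ g p = g'.restrictScalars ℝ := (hg.restrictScalars ℝ).fderiv
  rw [derivAlong, h, ← rePart_add_smul_imPart v, map_add, map_smul]
  rfl

/-- The derivative of a holomorphic function of `g` and its conjugate, `g` being holomorphic. -/
theorem derivAlong_comp_star {H : Type*} [NormedAddCommGroup H] [NormedSpace ℂ H]
    [StarAddMonoid H] [NormedStarGroup H] [StarModule ℂ H] {g : (Fin n → ℂ) → H}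
    {g' : (Fin n → ℂ) →L[ℂ] H} {p : Fin n → ℂ} (hg : HasFDerivAt g g' p) {K : H × H → F}
    {K' : H × H →L[ℂ] F} (hK : HasFDerivAt K K' (g p, star (g p))) (v : CVec n) :
    HasFDerivAt (𝕜 := ℝ) (fun x => K (g x, star (g x)))
      ((K'.restrictScalars ℝ).comp ((g'.restrictScalars ℝ).prod
        ((starL' ℝ (A := H)).toContinuousLinearMap.comp (g'.restrictScalars ℝ)))) p ∧
    derivAlong (fun x => K (g x, star (g x))) p v = K' (g' v.1, star (g' (star v.2))) := by
  have hgr := hg.restrictScalars ℝ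
  have hs : HasFDerivAt (fun x => star (g x))
      ((starL' ℝ (A := H)).toContinuousLinearMap.comp (g'.restrictScalars ℝ)) p :=
    ((starL' ℝ (A := H)).toContinuousLinearMap.hasFDerivAt).comp p hgr
  have h := (hK.restrictScalars ℝ).comp p (hgr.prodMk hs)
  refine ⟨h, ?_⟩
  have h' : fderiv ℝ (fun x => K (g x, star (g x))) p = _ := h.fderiv
  rw [derivAlong, h']
  have e1 : ∀ w, (((K'.restrictScalars ℝ).comp ((g'.restrictScalars ℝ).prod
      ((starL' ℝ (A := H)).toContinuousLinearMap.comp (g'.restrictScalars ℝ)))) : _ →L[ℝ] F) w =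
      K' (g' w, star (g' w)) := fun w => rfl
  -- In the conjugated slot, `star (g' X) + i star (g' Y) = star (g' (X - iY))`, which is where the
  -- `(0,1)` part enters.
  rw [e1, e1, ← map_smul, ← map_add, ← rePart_add_smul_imPart v, ← rePart_sub_smul_imPart v]
  congr 1
  ext1
  · simp
  · simp

/-- The bracket of two complex vector fields acts on functions as their commutator. -/
theorem derivAlong_bracket {g : (Fin n → ℂ) → F} {X Y : (Fin n → ℂ) → CVec n} {p : Fin n → ℂ}
    (hg : ContDiffAt ℝ 2 g p) (hX : DifferentiableAt ℝ X p) (hY : DifferentiableAt ℝ Y p) :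
    derivAlong g p (bracket X Y p) =
      derivAlong (fun q => derivAlong g q (Y q)) p (X p) -
        derivAlong (fun q => derivAlong g q (X q)) p (Y p) := by
  have hD : DifferentiableAt ℝ (fderiv ℝ g) p :=
    (hg.fderiv_right (m := 1) (by norm_num)).differentiableAt (by norm_num)
  have hsymm : ∀ u w, fderiv ℝ (fderiv ℝ g) p u w = fderiv ℝ (fderiv ℝ g) p w u := fun u w =>
    (hg.isSymmSndFDerivAt (by simp)) u w
  have key : ∀ {Z : (Fin n → ℂ) → CVec n}, DifferentiableAt ℝ Z p → ∀ u,
      fderiv ℝ (fun q => derivAlong g q (Z q)) p u =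
      (fderiv ℝ (fderiv ℝ g) p u (rePart (Z p)) + I • fderiv ℝ (fderiv ℝ g) p u (imPart (Z p))) +
        derivAlong g p (fderiv ℝ Z p u) := by
    intro Z hZ u
    have hre : HasFDerivAt (fun q => rePart (Z q)) ((rePartL n).comp (fderiv ℝ Z p)) p :=
      (rePartL n).hasFDerivAt.comp p hZ.hasFDerivAt
    have him : HasFDerivAt (fun q => imPart (Z q)) ((imPartL n).comp (fderiv ℝ Z p)) p :=
      (imPartL n).hasFDerivAt.comp p hZ.hasFDerivAt
    have h1 := (hD.hasFDerivAt.clm_apply hre).add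
      ((hD.hasFDerivAt.clm_apply him).const_smul I)
    have h2 : fderiv ℝ (fun q => derivAlong g q (Z q)) p = _ := h1.fderiv
    rw [h2]
    simp only [derivAlong, add_apply, ContinuousLinearMap.comp_apply, smul_apply, smul_add,
      ContinuousLinearMap.flip_apply, rePartL_apply, imPartL_apply]
    abel
  -- The first bracket is the complex bilinear extension of the second derivative, evaluated at `W`
  -- and `Z`. It is symmetric, so it disappears from the commutator and only the derivatives of the
  -- coefficients survive.
  have e : ∀ {Z W : (Fin n → ℂ) → CVec n}, DifferentiableAt ℝ Z p →
      derivAlong (fun q => derivAlong g q (Z q)) p (W p) =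
      (fderiv ℝ (fderiv ℝ g) p (rePart (W p)) (rePart (Z p)) +
        I • fderiv ℝ (fderiv ℝ g) p (rePart (W p)) (imPart (Z p)) +
        I • fderiv ℝ (fderiv ℝ g) p (imPart (W p)) (rePart (Z p)) -
        fderiv ℝ (fderiv ℝ g) p (imPart (W p)) (imPart (Z p))) +
      derivAlong g p (derivAlong Z p (W p)) := by
    intro Z W hZ
    rw [derivAlong, key hZ, key hZ, derivAlong.eq_1 Z, derivAlong_add_right,
      derivAlong_I_smul_right]
    simp only [smul_add, smul_smul, I_mul_I, neg_smul, one_smul]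
    abel
  rw [e hY, e hX, bracket, ← derivAlongL_apply, map_sub, derivAlongL_apply, derivAlongL_apply,
    hsymm (rePart (X p)) (rePart (Y p)), hsymm (rePart (X p)) (imPart (Y p)),
    hsymm (imPart (X p)) (rePart (Y p)), hsymm (imPart (X p)) (imPart (Y p))]
  abel

theorem analyticAt_derivAlong [CompleteSpace F] {g : (Fin n → ℂ) → F} {X : (Fin n → ℂ) → CVec n}
    {p : Fin n → ℂ} (hg : AnalyticAt ℝ g p) (hX : AnalyticAt ℝ X p) :
    AnalyticAt ℝ (fun q => derivAlong g q (X q)) p := by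
  have h1 : AnalyticAt ℝ (fun q => rePart (X q)) p := ((rePartL n).analyticAt _).comp hX
  have h2 : AnalyticAt ℝ (fun q => imPart (X q)) p := ((imPartL n).analyticAt _).comp hX
  have ev : ∀ {v : (Fin n → ℂ) → (Fin n → ℂ)}, AnalyticAt ℝ v p →
      AnalyticAt ℝ (fun q => fderiv ℝ g q (v q)) p := by
    intro v hv
    have hb : AnalyticAt ℝ (fun z : ((Fin n → ℂ) →L[ℝ] F) × (Fin n → ℂ) => z.1 z.2)
        (fderiv ℝ g p, v p) :=
      (ContinuousLinearMap.id ℝ ((Fin n → ℂ) →L[ℝ] F)).analyticAt_bilinear _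
    exact hb.comp (f := fun q => (fderiv ℝ g q, v q)) (hg.fderiv.prod hv)
  have e3 : AnalyticAt ℝ (fun q => I • fderiv ℝ g q (imPart (X q))) p :=
    (((I • ContinuousLinearMap.id ℂ F).restrictScalars ℝ).analyticAt _).comp (ev h2)
  exact (ev h1).add e3

theorem analyticAt_conjField {X : (Fin n → ℂ) → CVec n} {p : Fin n → ℂ} (hX : AnalyticAt ℝ X p) :
    AnalyticAt ℝ (conjField X) p := by
  have hs : ∀ v : Fin n → ℂ, AnalyticAt ℝ (fun w : Fin n → ℂ => star w) v := fun v =>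
    (starL' ℝ (A := Fin n → ℂ)).toContinuousLinearMap.analyticAt v
  have h1 : AnalyticAt ℝ (fun q => (X q).1) p := analyticAt_fst.comp hX
  have h2 : AnalyticAt ℝ (fun q => (X q).2) p := analyticAt_snd.comp hX
  exact ((hs _).comp h2).prod ((hs _).comp h1)

theorem analyticAt_bracket {X Y : (Fin n → ℂ) → CVec n} {p : Fin n → ℂ}
    (hX : AnalyticAt ℝ X p) (hY : AnalyticAt ℝ Y p) : AnalyticAt ℝ (bracket X Y) p :=
  (analyticAt_derivAlong hY hX).sub (analyticAt_derivAlong hX hY)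

/-- The tangent space of a submanifold is the kernel of the derivative of a defining function. -/
theorem tangentVectors_eq_ker {c : ℕ} {M U : Set (Fin n → ℂ)} {ρ : (Fin n → ℂ) → (Fin c → ℝ)}
    {p : Fin n → ℂ} (hU : IsOpen U) (hM : M ∩ U = {q ∈ U | ρ q = 0}) (hp : p ∈ M ∩ U)
    (hρ : AnalyticAt ℝ ρ p) (hs : Function.Surjective (fderiv ℝ ρ p)) :
    tangentVectors M p = {v | fderiv ℝ ρ p v = 0} := by
  have hmem : ∀ q ∈ U, (q ∈ M ↔ ρ q = 0) := fun q hq => by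
    have := Set.ext_iff.1 hM q
    simpa [hq] using this
  have hp0 : ρ p = 0 := (hmem p hp.2).1 hp.1
  ext v
  constructor
  · rintro ⟨γ, h0, hγ, hd⟩
    have hcont : Tendsto γ (𝓝 0) (𝓝 p) := by
      have := hd.continuousAt.tendsto
      rwa [h0] at this
    have hz : (fun t => ρ (γ t)) =ᶠ[𝓝 0] fun _ => 0 := by
      filter_upwards [hγ, hcont.eventually (hU.mem_nhds hp.2)] with t h1 h2
      exact (hmem _ h2).1 h1
    have hρd : HasFDerivAt ρ (fderiv ℝ ρ p) (γ 0) := by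
      rw [h0]; exact hρ.differentiableAt.hasFDerivAt
    have h1 := hρd.comp_hasDerivAt 0 hd
    exact (h1.congr_of_eventuallyEq hz.symm).unique (hasDerivAt_const _ _)
  · intro hv
    have hst : HasStrictFDerivAt ρ (fderiv ℝ ρ p) p := hρ.hasStrictFDerivAt
    have hr : (fderiv ℝ ρ p).range = ⊤ := LinearMap.range_eq_top.2 hs
    -- The implicit function parametrizes the level set by the kernel, with the inclusion as its
    -- derivative; the image of the line `t ↦ t w` is a curve in `M` with velocity `v`.
    let w : (fderiv ℝ ρ p).ker := ⟨v, hv⟩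
    have hline : HasDerivAt (fun t : ℝ => t • w) w 0 := by
      simpa using! (hasDerivAt_id (0 : ℝ)).smul_const w
    refine ⟨fun t => hst.implicitFunction ρ _ hr (ρ p) (t • w), ?_, ?_, ?_⟩
    · simp
    · have hc : Tendsto (fun t : ℝ => (ρ p, t • w)) (𝓝 0) (𝓝 (ρ p, 0)) := by
        have := hline.continuousAt.tendsto
        simp only [zero_smul] at this
        exact tendsto_const_nhds.prodMk_nhds this
      have hi : Tendsto (fun t : ℝ => hst.implicitFunction ρ _ hr (ρ p) (t • w)) (𝓝 0) (𝓝 p) := by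
        have := hline.continuousAt.tendsto
        simp only [zero_smul] at this
        exact hst.tendsto_implicitFunction hr tendsto_const_nhds this
      filter_upwards [hc.eventually (hst.map_implicitFunction_eq hr),
        hi.eventually (hU.mem_nhds hp.2)] with t h1 h2
      exact (hmem _ h2).2 (h1.trans hp0)
    · have h1 := (hst.to_implicitFunction hr).hasFDerivAt
      have h2 : HasFDerivAt (hst.implicitFunction ρ _ hr (ρ p)) (fderiv ℝ ρ p).ker.subtypeL
          ((0 : ℝ) • w) := by rwa [zero_smul]
      exact h2.comp_hasDerivAt 0 hline

end CRGeometry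

/-! ### Complexified defining functions -/

namespace CRGeometry

open Complex Set Filter Topology Asymptotics

/-- A real analytic function of several complex variables extends to a holomorphic function of
these variables and of their conjugates, taken as independent variables. -/
theorem exists_complexification_star {m : ℕ} {f : (Fin m → ℂ) → ℝ} (hf : AnalyticAt ℝ f 0) :
    ∃ K : (Fin m → ℂ) × (Fin m → ℂ) → ℂ, AnalyticAt ℂ K 0 ∧
      (∀ᶠ x in 𝓝 0, K (x, star x) = f x) ∧
      ∀ᶠ P in 𝓝 (0 : (Fin m → ℂ) × (Fin m → ℂ)), K (star P.2, star P.1) = star (K P) := by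
  let N : ((Fin m ⊕ Fin m) → ℝ) →L[ℝ] (Fin m → ℂ) :=
    LinearMap.toContinuousLinearMap
      { toFun := fun t k => (t (Sum.inl k) : ℂ) + I * t (Sum.inr k)
        map_add' := fun t s => by ext k; simp; ring
        map_smul' := fun c t => by ext k; simp; ring }
  -- These are the polarized real and imaginary parts: on pairs `(x, star x)` they take the values
  -- `Re x` and `Im x`, and swapping and conjugating the pair conjugates them.
  let B : (Fin m → ℂ) × (Fin m → ℂ) →L[ℂ] ((Fin m ⊕ Fin m) → ℂ) :=
    LinearMap.toContinuousLinearMap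
      { toFun := fun P => Sum.elim (fun k => (P.1 k + P.2 k) / 2)
          (fun k => (P.1 k - P.2 k) / (2 * I))
        map_add' := fun t s => by ext k; rcases k with k | k <;> simp <;> ring
        map_smul' := fun c t => by ext k; rcases k with k | k <;> simp <;> ring }
  have hBapp : ∀ P, B P = Sum.elim (fun k => (P.1 k + P.2 k) / 2)
          (fun k => (P.1 k - P.2 k) / (2 * I)) := fun _ => rfl
  have hfN : AnalyticAt ℝ (fun t => f (N t)) 0 := by
    have : AnalyticAt ℝ f (N 0) := by rwa [map_zero]
    exact this.comp (N.analyticAt 0)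
  obtain ⟨K, hK, hKr, hKs⟩ := exists_complexification hfN
  have hB0 : Tendsto B (𝓝 0) (𝓝 0) := by
    have := B.continuous.tendsto 0
    rwa [map_zero] at this
  refine ⟨fun P => K (B P), ?_, ?_, ?_⟩
  · have : AnalyticAt ℂ K (B 0) := by rwa [map_zero]
    exact this.comp (B.analyticAt 0)
  · let T : (Fin m → ℂ) → ((Fin m ⊕ Fin m) → ℝ) :=
      fun x => Sum.elim (fun k => (x k).re) (fun k => (x k).im)
    have hT : Tendsto T (𝓝 0) (𝓝 0) := by
      have hc : Continuous T := by
        refine continuous_pi fun k => ?_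
        rcases k with k | k
        · exact continuous_re.comp (continuous_apply k)
        · exact continuous_im.comp (continuous_apply k)
      have := hc.tendsto 0
      convert this using 2
      ext k
      rcases k with k | k <;> simp [T]
    filter_upwards [hT.eventually hKr] with x hx
    have h1 : N (T x) = x := by
      ext k
      change (((x k).re : ℝ) : ℂ) + I * ((x k).im : ℝ) = x k
      rw [mul_comm, re_add_im]
    have h2 : (fun k => ((T x) k : ℂ)) = B (x, star x) := by
      rw [hBapp]
      ext k
      rcases k with k | k
      · simp [T, add_conj]
      · simp [T, sub_conj]
        field_simp
    rw [← h2, hx, h1]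
  · filter_upwards [hB0.eventually hKs] with P hP
    rw [← hP]
    congr 1
    simp only [hBapp]
    ext k
    rcases k with k | k
    · simp [add_comm]
    · simp
      rw [← neg_div_neg_eq]
      simp

/-- The space `ℂ × ℂ³` of the coordinates `(z, w)`. -/
abbrev CoordSpace : Type := ℂ × (Fin 3 → ℂ)

/-- The pairs `(P, star P)` form a totally real subspace that spans over `ℂ`, so a complex linear
map is determined by its restriction to it. This transfers real derivatives to complexifications. -/
theorem fderiv_eq_of_real {F : Type*} [NormedAddCommGroup F] [NormedSpace ℂ F]
    {S T : CoordSpace × CoordSpace →L[ℂ] F} (h : ∀ P, S (P, star P) = T (P, star P)) : S = T := by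
  refine ContinuousLinearMap.ext fun v => ?_
  have hv : v = (((1 / 2 : ℂ) • (v.1 + star v.2), star ((1 / 2 : ℂ) • (v.1 + star v.2))) :
      CoordSpace × CoordSpace) +
      I • (((1 / (2 * I) : ℂ) • (v.1 - star v.2), star ((1 / (2 * I) : ℂ) • (v.1 - star v.2))) :
      CoordSpace × CoordSpace) := by
    ext <;> simp <;> field_simp <;> ring_nf <;> simp <;> ring
  rw [hv, map_add, map_add, map_smul, map_smul, h, h]

/-- A complex linear form with given imaginary part, in several dimensions. -/
theorem exists_linear_im (d : (Fin 4 → ℂ) →L[ℝ] (Fin 3 → ℝ)) :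
    ∃ Λ : (Fin 4 → ℂ) →ₗ[ℂ] (Fin 3 → ℂ), ∀ v j, Λ v j = d (I • v) j + I * d v j := by
  refine ⟨{ toFun := fun v j => d (I • v) j + I * d v j, map_add' := ?_, map_smul' := ?_ },
    fun _ _ => rfl⟩
  · intro v w; ext j; simp; ring
  · intro c v
    ext j
    have h1 : c • v = c.re • v + c.im • (I • v) := by
      conv_lhs => rw [← re_add_im c]
      rw [add_smul, mul_smul]
      rfl
    have h2 : I • c • v = c.re • (I • v) - c.im • v := by
      rw [h1, smul_add, smul_comm I c.re, smul_comm I c.im, smul_smul I I, I_mul_I]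
      simp [sub_eq_add_neg]
    rw [h2, h1]
    simp
    conv_rhs => rw [← re_add_im c]
    ring_nf
    simp
    ring

/-- The form with imaginary part `d` supplies the three `w`-coordinates. Genericity makes it
surjective: if `d (a + I b) = u` with `d a = d b = 0`, its value at `b` is `u`. Its kernel, the
holomorphic tangent space, is thus a line, and any ambient coordinate nonzero on that line can serve
as `z`. -/
theorem exists_linear_coordinates (d : (Fin 4 → ℂ) →L[ℝ] (Fin 3 → ℝ))
    (hd : Function.Surjective d)
    (hg : ∀ v, ∃ a b, d a = 0 ∧ d b = 0 ∧ v = a + I • b) :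
    ∃ A : (Fin 4 → ℂ) ≃L[ℂ] CoordSpace, ∀ v j, d v j = ((A v).2 j).im := by
  obtain ⟨Λ, hΛ⟩ := exists_linear_im d
  have him : ∀ v j, d v j = (Λ v j).im := fun v j => by rw [hΛ]; simp
  have hreal : ∀ u : Fin 3 → ℝ, ∃ v, ∀ j, Λ v j = u j := by
    intro u
    obtain ⟨v, hv⟩ := hd u
    obtain ⟨a, b, ha, hb, rfl⟩ := hg v
    refine ⟨b, fun j => ?_⟩
    rw [map_add, ha, zero_add] at hv
    rw [hΛ, hv, hb]
    simp
  have hsurj : Function.Surjective Λ := by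
    intro y
    obtain ⟨v, hv⟩ := hreal fun j => (y j).re
    obtain ⟨w, hw⟩ := hreal fun j => (y j).im
    refine ⟨v + I • w, ?_⟩
    ext j
    rw [map_add, map_smul, Pi.add_apply, Pi.smul_apply, hv, hw, smul_eq_mul, mul_comm, re_add_im]
  have hker : Module.finrank ℂ Λ.ker = 1 := by
    have h1 := Λ.finrank_range_add_finrank_ker
    rw [LinearMap.range_eq_top.2 hsurj, finrank_top] at h1
    simp at h1
    omega
  obtain ⟨e, he, hspan⟩ := finrank_eq_one_iff'.1 hker
  obtain ⟨i, hi⟩ : ∃ i, (e : Fin 4 → ℂ) i ≠ 0 := by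
    by_contra! h
    exact he (Subtype.ext (funext h))
  let A₀ : (Fin 4 → ℂ) →ₗ[ℂ] CoordSpace := (LinearMap.proj i).prod Λ
  have hinj : Function.Injective A₀ := by
    rw [← LinearMap.ker_eq_bot, LinearMap.ker_eq_bot']
    intro v hv
    have hv1 : v i = 0 := congrArg Prod.fst hv
    have hv2 : Λ v = 0 := congrArg Prod.snd hv
    obtain ⟨c, hc⟩ := hspan ⟨v, hv2⟩
    have hc' : c • (e : Fin 4 → ℂ) = v := congrArg Subtype.val hc
    have : c = 0 := by
      rw [← hc'] at hv1
      simpa [hi] using hv1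
    rw [← hc', this, zero_smul]
  refine ⟨(LinearEquiv.ofInjectiveOfFinrankEq A₀ hinj (by simp)).toContinuousLinearEquiv,
    fun v j => ?_⟩
  rw [him]
  rfl

/-- Complexified defining functions of a CR-generic submanifold, in linear coordinates in which the
tangent space at the origin is `Im w = 0`. -/
theorem exists_complexified_defining_function {M : Set (Fin 4 → ℂ)} (h0 : (0 : Fin 4 → ℂ) ∈ M)
    (hM : IsAnalyticSubmanifold 3 M) (hG : IsCRGeneric M) :
    ∃ (A : (Fin 4 → ℂ) ≃L[ℂ] CoordSpace) (U : Set (Fin 4 → ℂ))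
      (ρ : (Fin 4 → ℂ) → (Fin 3 → ℝ)) (r : CoordSpace × CoordSpace → (Fin 3 → ℂ)),
      (IsOpen U ∧ (0 : Fin 4 → ℂ) ∈ U ∧ AnalyticOnNhd ℝ ρ U ∧
        (∀ q ∈ U, Function.Surjective (fderiv ℝ ρ q)) ∧ M ∩ U = {q ∈ U | ρ q = 0}) ∧
      AnalyticAt ℂ r 0 ∧
      (∀ᶠ x in 𝓝 0, r (A x, star (A x)) = fun j => (ρ x j : ℂ)) ∧
      (∀ᶠ P in 𝓝 (0 : CoordSpace × CoordSpace), r (star P.2, star P.1) = star (r P)) ∧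
      ∀ P, fderiv ℂ r 0 P = (1 / (2 * I) : ℂ) • (P.1.2 - P.2.2) := by
  obtain ⟨U, hU, h0U, ρ, hρ, hs, hMU⟩ := hM 0 h0
  have hT := tangentVectors_eq_ker hU hMU ⟨h0, h0U⟩ (hρ 0 h0U) (hs 0 h0U)
  obtain ⟨A, hA⟩ := exists_linear_coordinates (fderiv ℝ ρ 0) (hs 0 h0U) (fun v => by
    obtain ⟨a, ha, b, hb, hv⟩ := hG 0 h0 v
    rw [hT] at ha hb
    exact ⟨a, b, ha, hb, hv⟩)
  -- Unlike `A`, this identification commutes with conjugation, so reality of the complexification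
  -- carries over to `CoordSpace`.
  let c : CoordSpace ≃L[ℂ] (Fin 4 → ℂ) := Fin.consEquivL ℂ (fun _ : Fin 4 => ℂ)
  have hcs : ∀ P : CoordSpace, c (star P) = star (c P) := by
    intro P
    ext k
    refine Fin.cases ?_ (fun j => ?_) k <;> rfl
  let D : (Fin 4 → ℂ) →L[ℂ] (Fin 4 → ℂ) :=
    (A.symm : CoordSpace →L[ℂ] (Fin 4 → ℂ)).comp (c.symm : (Fin 4 → ℂ) →L[ℂ] CoordSpace)
  have hDc : ∀ x, D (c (A x)) = x := fun x => by simp [D]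
  have hfj : ∀ j, AnalyticAt ℝ (fun y => ρ (D y) j) 0 := by
    intro j
    have h1 : AnalyticAt ℝ ρ (D 0) := by rw [map_zero]; exact hρ 0 h0U
    have h2 : AnalyticAt ℝ (fun y => ρ (D y)) 0 :=
      h1.comp ((D.restrictScalars ℝ).analyticAt 0)
    exact ((ContinuousLinearMap.proj (R := ℝ) (φ := fun _ : Fin 3 => ℝ) j).analyticAt _).comp h2
  choose K hK hKr hKs using fun j => exists_complexification_star (hfj j)
  let C : CoordSpace × CoordSpace →L[ℂ] (Fin 4 → ℂ) × (Fin 4 → ℂ) :=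
    (c : CoordSpace →L[ℂ] (Fin 4 → ℂ)).prodMap (c : CoordSpace →L[ℂ] (Fin 4 → ℂ))
  have hC : ∀ P, C P = (c P.1, c P.2) := fun _ => rfl
  have hr : AnalyticAt ℂ (fun P j => K j (C P)) 0 := by
    refine AnalyticAt.pi fun j => ?_
    have : AnalyticAt ℂ (K j) (C 0) := by rw [map_zero]; exact hK j
    exact this.comp (C.analyticAt 0)
  have hrr : ∀ᶠ x in 𝓝 0, (fun P j => K j (C P)) (A x, star (A x)) =
      fun j => (ρ x j : ℂ) := by
    have ht : Tendsto (fun x => c (A x)) (𝓝 0) (𝓝 0) := by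
      have := (c.continuous.comp A.continuous).tendsto 0
      simpa using! this
    filter_upwards [ht.eventually (eventually_all.2 hKr)] with x hx
    ext j
    simp only [hC, hcs, hx j, hDc]
  refine ⟨A, U, ρ, fun P j => K j (C P), ⟨hU, h0U, hρ, hs, hMU⟩, hr, hrr, ?_, ?_⟩
  · have ht : Tendsto C (𝓝 0) (𝓝 0) := by
      have := C.continuous.tendsto 0
      rwa [map_zero] at this
    filter_upwards [ht.eventually (eventually_all.2 hKs)] with P hP
    ext j
    have := hP j
    simp only [hC] at this ⊢
    rw [hcs, hcs, this]
    rfl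
  · have key : fderiv ℂ (fun P j => K j (C P)) 0 = (1 / (2 * I) : ℂ) •
        ((ContinuousLinearMap.snd ℂ ℂ (Fin 3 → ℂ)).comp
          (ContinuousLinearMap.fst ℂ CoordSpace CoordSpace) -
        (ContinuousLinearMap.snd ℂ ℂ (Fin 3 → ℂ)).comp
          (ContinuousLinearMap.snd ℂ CoordSpace CoordSpace)) := by
      refine fderiv_eq_of_real fun P => ?_
      obtain ⟨x, rfl⟩ := A.surjective P
      have hA' : HasFDerivAt A (A : (Fin 4 → ℂ) →L[ℂ] CoordSpace) 0 := A.hasFDerivAt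
      have hr' : HasFDerivAt (fun P j => K j (C P)) (fderiv ℂ (fun P j => K j (C P)) 0)
          (A 0, star (A 0)) := by
        have : ((A 0, star (A 0)) : CoordSpace × CoordSpace) = 0 := by simp
        rw [this]; exact hr.differentiableAt.hasFDerivAt
      have h1 := (derivAlong_comp_star hA' hr' 0).1
      have hofr : HasFDerivAt (fun x j => (ρ x j : ℂ))
          ((ContinuousLinearMap.pi fun j => ofRealCLM.comp ((ContinuousLinearMap.proj
            (R := ℝ) (φ := fun _ : Fin 3 => ℝ) j).comp (fderiv ℝ ρ 0)))) 0 := by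
        refine hasFDerivAt_pi.2 fun j => ?_
        exact ofRealCLM.hasFDerivAt.comp (0 : Fin 4 → ℂ)
          (((ContinuousLinearMap.proj (R := ℝ) (φ := fun _ : Fin 3 => ℝ) j).hasFDerivAt).comp
            (0 : Fin 4 → ℂ) (hρ 0 h0U).differentiableAt.hasFDerivAt)
      have h2 := (h1.congr_of_eventuallyEq (hrr.mono fun x hx => hx.symm)).unique hofr
      have h3 := DFunLike.congr_fun h2 x
      refine Eq.trans h3 ?_
      ext j
      have e1 : (((fderiv ℝ ρ 0 x j : ℝ)) : ℂ) = (1 / (2 * I) : ℂ) *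
          ((A x).2 j - star ((A x).2 j)) := by
        rw [hA, star_def, sub_conj]
        push_cast
        field_simp
      exact e1
    intro P
    rw [key]
    rfl

end CRGeometry

/-! ### Normal coordinates -/

namespace CRGeometry

open Complex Set Filter Topology Asymptotics

section ZeroGerms

variable {X Y Z : Type*} [NormedAddCommGroup X] [NormedSpace ℂ X] [NormedAddCommGroup Y]
  [NormedSpace ℂ Y] [NormedAddCommGroup Z] [NormedSpace ℂ Z]

theorem tendsto_zero_of_analyticAt {f : X → Y} (hf : AnalyticAt ℂ f 0) (h0 : f 0 = 0) :
    Tendsto f (𝓝 0) (𝓝 0) := by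
  have := hf.continuousAt.tendsto
  rwa [h0] at this

theorem tendsto_zero_pair {X Y W : Type*} [Zero X] [TopologicalSpace X] [Zero Y]
    [TopologicalSpace Y] {l : Filter W} {f : W → X} {g : W → Y}
    (hf : Tendsto f l (𝓝 0)) (hg : Tendsto g l (𝓝 0)) :
    Tendsto (fun x => (f x, g x)) l (𝓝 (0 : X × Y)) :=
  hf.prodMk_nhds hg

theorem tendsto_zero_star {S : Type*} [NormedAddCommGroup S] [StarAddMonoid S] [NormedStarGroup S]
    {W : Type*} {l : Filter W} {f : W → S} (hf : Tendsto f l (𝓝 0)) :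
    Tendsto (fun x => star (f x)) l (𝓝 0) := by
  have := hf.star
  rwa [star_zero] at this

theorem tendsto_zero_fst {X Y : Type*} [Zero X] [TopologicalSpace X] [Zero Y]
    [TopologicalSpace Y] : Tendsto (fun p : X × Y => p.1) (𝓝 0) (𝓝 0) :=
  continuous_fst.tendsto 0

theorem tendsto_zero_snd {X Y : Type*} [Zero X] [TopologicalSpace X] [Zero Y]
    [TopologicalSpace Y] : Tendsto (fun p : X × Y => p.2) (𝓝 0) (𝓝 0) :=
  continuous_snd.tendsto 0

theorem analyticAt_comp_zero {f : Y → Z} {g : X → Y} (hf : AnalyticAt ℂ f 0)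
    (hg : AnalyticAt ℂ g 0) (g0 : g 0 = 0) : AnalyticAt ℂ (fun x => f (g x)) 0 := by
  have : AnalyticAt ℂ f (g 0) := by rwa [g0]
  exact this.comp hg

theorem fderiv_comp_zero {f : Y → Z} {g : X → Y} (hf : AnalyticAt ℂ f 0)
    (hg : AnalyticAt ℂ g 0) (g0 : g 0 = 0) (v : X) :
    fderiv ℂ (fun x => f (g x)) 0 v = fderiv ℂ f 0 (fderiv ℂ g 0 v) := by
  have hf' : HasFDerivAt f (fderiv ℂ f 0) (g 0) := by
    rw [g0]; exact hf.differentiableAt.hasFDerivAt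
  have h : fderiv ℂ (fun x => f (g x)) 0 = _ :=
    (hf'.comp (0 : X) hg.differentiableAt.hasFDerivAt).fderiv
  rw [h]
  rfl

theorem fderiv_pair_apply {f : X → Y} {g : X → Z} {x : X} (hf : AnalyticAt ℂ f x)
    (hg : AnalyticAt ℂ g x) (v : X) :
    fderiv ℂ (fun x => (f x, g x)) x v = (fderiv ℂ f x v, fderiv ℂ g x v) := by
  rw [hf.differentiableAt.fderiv_prodMk hg.differentiableAt]
  rfl

theorem _root_.IsLinearMap.analyticAt_of_finiteDimensional [FiniteDimensional ℂ X] {g : X → Y}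
    (hg : IsLinearMap ℂ g) (x : X) : AnalyticAt ℂ g x :=
  (LinearMap.toContinuousLinearMap (hg.mk' g)).analyticAt x

theorem _root_.IsLinearMap.fderiv_apply_of_finiteDimensional [FiniteDimensional ℂ X] {g : X → Y}
    (hg : IsLinearMap ℂ g) (x v : X) : fderiv ℂ g x v = g v := by
  have h : fderiv ℂ g x = LinearMap.toContinuousLinearMap (hg.mk' g) :=
    (LinearMap.toContinuousLinearMap (hg.mk' g)).hasFDerivAt.fderiv
  rw [h]
  rfl

end ZeroGerms

/-- A holomorphic change of coordinates after which the complexified defining function `R` of a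
generic submanifold satisfies `R = 0` at the points `((z, s), (0, s))` and `((0, s), (z, s))`. -/
theorem exists_normal_coordinates {r : CoordSpace × CoordSpace → (Fin 3 → ℂ)}
    (hr : AnalyticAt ℂ r 0) (hr0 : r 0 = 0)
    (hrs : ∀ᶠ P in 𝓝 (0 : CoordSpace × CoordSpace), r (star P.2, star P.1) = star (r P))
    (hrd : ∀ P, fderiv ℂ r 0 P = (1 / (2 * I) : ℂ) • (P.1.2 - P.2.2)) :
    ∃ (Ψ : CoordSpace → CoordSpace) (R : CoordSpace × CoordSpace → (Fin 3 → ℂ)),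
      AnalyticAt ℂ Ψ 0 ∧ Ψ 0 = 0 ∧ (∀ v, fderiv ℂ Ψ 0 v = v) ∧ AnalyticAt ℂ R 0 ∧
      (∀ᶠ ξ in 𝓝 0, R (ξ, star ξ) = r (Ψ ξ, star (Ψ ξ))) ∧
      (∀ᶠ P in 𝓝 (0 : CoordSpace × CoordSpace), R (star P.2, star P.1) = star (R P)) ∧
      (∀ P, fderiv ℂ R 0 P = (1 / (2 * I) : ℂ) • (P.1.2 - P.2.2)) ∧
      ∀ᶠ ξ in 𝓝 (0 : CoordSpace), R (ξ, (0, ξ.2)) = 0 ∧ R ((0, ξ.2), ξ) = 0 := by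
  have hI : (1 / (2 * I) : ℂ) ≠ 0 := by simp
  have hI' : (-(1 / (2 * I)) : ℂ) ≠ 0 := neg_ne_zero.2 hI
  -- solving for `w` and for `τ`
  let g1 : (ℂ × ℂ × (Fin 3 → ℂ)) × (Fin 3 → ℂ) → CoordSpace × CoordSpace :=
    fun p => ((p.1.1, p.2), (p.1.2.1, p.1.2.2))
  have hg1 : IsLinearMap ℂ g1 := ⟨fun _ _ => rfl, fun _ _ => rfl⟩
  let g2 : (ℂ × ℂ × (Fin 3 → ℂ)) × (Fin 3 → ℂ) → CoordSpace × CoordSpace :=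
    fun p => ((p.1.2.1, p.1.2.2), (p.1.1, p.2))
  have hg2 : IsLinearMap ℂ g2 := ⟨fun _ _ => rfl, fun _ _ => rfl⟩
  have ha1 := hg1.analyticAt_of_finiteDimensional 0
  have ha2 := hg2.analyticAt_of_finiteDimensional 0
  have hd1 : ∀ v, fderiv ℂ (fun p => r (g1 p)) 0 v = (1 / (2 * I) : ℂ) • (v.2 - v.1.2.2) := by
    intro v
    rw [fderiv_comp_zero hr ha1 hg1.map_zero, hg1.fderiv_apply_of_finiteDimensional, hrd]
  have hd2 : ∀ v, fderiv ℂ (fun p => r (g2 p)) 0 v = (1 / (2 * I) : ℂ) • (v.1.2.2 - v.2) := by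
    intro v
    rw [fderiv_comp_zero hr ha2 hg2.map_zero, hg2.fderiv_apply_of_finiteDimensional, hrd]
  obtain ⟨Q, hQ, hQ0, hQe, hQd⟩ := exists_analyticAt_implicit
    (analyticAt_comp_zero hr ha1 hg1.map_zero) (by rw [hg1.map_zero, hr0]) hI
    (fun y => by rw [hd1]; simp)
  obtain ⟨Qb, hQb, hQb0, hQbe, hQbd⟩ := exists_analyticAt_implicit
    (analyticAt_comp_zero hr ha2 hg2.map_zero) (by rw [hg2.map_zero, hr0]) hI'
    (fun y => by rw [hd2]; simp)
  have hQd' : ∀ x, fderiv ℂ Q 0 x = x.2.2 := fun x => by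
    have := hQd x
    rw [hd1, ← smul_neg] at this
    simpa using smul_right_injective _ hI this
  have hQbd' : ∀ x, fderiv ℂ Qb 0 x = x.2.2 := fun x => by
    have := hQbd x
    rw [hd2, ← neg_smul] at this
    simpa using smul_right_injective _ hI' this
  have tQ := tendsto_zero_of_analyticAt hQ hQ0
  -- `w = Q` and `τ = Qb` are two solved forms of the same equation `r = 0`, hence equivalent near
  -- the origin.
  have dual : ∀ᶠ P in 𝓝 (0 : CoordSpace × CoordSpace),
      (P.1.2 = Q (P.1.1, P.2.1, P.2.2) ↔ P.2.2 = Qb (P.2.1, P.1.1, P.1.2)) ∧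
      (r P = 0 ↔ P.2.2 = Qb (P.2.1, P.1.1, P.1.2)) := by
    have t1 : Tendsto (fun P : CoordSpace × CoordSpace => ((P.1.1, P.2.1, P.2.2), P.1.2))
        (𝓝 0) (𝓝 0) := by
      have : Continuous (fun P : CoordSpace × CoordSpace => ((P.1.1, P.2.1, P.2.2), P.1.2)) := by
        fun_prop
      exact this.tendsto 0
    have t2 : Tendsto (fun P : CoordSpace × CoordSpace => ((P.2.1, P.1.1, P.1.2), P.2.2))
        (𝓝 0) (𝓝 0) := by
      have : Continuous (fun P : CoordSpace × CoordSpace => ((P.2.1, P.1.1, P.1.2), P.2.2)) := by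
        fun_prop
      exact this.tendsto 0
    filter_upwards [t1.eventually hQe, t2.eventually hQbe] with P h1 h2
    exact ⟨h1.symm.trans h2, h2⟩
  -- the graph of `M` over the real points of `z = 0`
  let k : (Fin 3 → ℂ) × (Fin 3 → ℂ) → ℂ × ℂ × (Fin 3 → ℂ) := fun p => (0, 0, p.1 - I • p.2)
  have hk : IsLinearMap ℂ k := by
    constructor
    · intro x y; ext <;> simp [k]; ring
    · intro c x; ext <;> simp [k]; ring
  have hka := hk.analyticAt_of_finiteDimensional 0
  have hfd : ∀ v : (Fin 3 → ℂ) × (Fin 3 → ℂ), fderiv ℂ (fun p => p.1 + I • p.2 - Q (k p)) 0 v =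
      (2 * I : ℂ) • v.2 := by
    intro v
    have hl : IsLinearMap ℂ (fun p : (Fin 3 → ℂ) × (Fin 3 → ℂ) => p.1 + I • p.2) := by
      constructor
      · intro x y; ext; simp; ring
      · intro c x; ext; simp; ring
    rw [fderiv_fun_sub (hl.analyticAt_of_finiteDimensional 0).differentiableAt
      (analyticAt_comp_zero hQ hka hk.map_zero).differentiableAt, sub_apply,
      hl.fderiv_apply_of_finiteDimensional, fderiv_comp_zero hQ hka hk.map_zero,
      hk.fderiv_apply_of_finiteDimensional, hQd']
    ext; simp [k]; ring
  obtain ⟨h, hh, hh0, hhe, hhd⟩ := exists_analyticAt_implicit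
    (f := fun p : (Fin 3 → ℂ) × (Fin 3 → ℂ) => p.1 + I • p.2 - Q (k p)) (by
      refine AnalyticAt.sub ?_ (analyticAt_comp_zero hQ hka hk.map_zero)
      exact analyticAt_fst.add (analyticAt_snd.const_smul (c := I))) (by rw [hk.map_zero, hQ0]; simp) (c := 2 * I) (by simp)
    (fun y => by rw [hfd])
  have hhd' : ∀ x, fderiv ℂ h 0 x = 0 := fun x => by
    have := hhd x
    rw [hfd] at this
    simpa using this
  have th := tendsto_zero_of_analyticAt hh hh0
  have tI : ∀ {W : Type} {l : Filter W} {f : W → (Fin 3 → ℂ)}, Tendsto f l (𝓝 0) →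
      Tendsto (fun x => I • f x) l (𝓝 0) := fun hf => by simpa using! hf.const_smul I
  have tadd : ∀ {W : Type} {l : Filter W} {f g : W → (Fin 3 → ℂ)}, Tendsto f l (𝓝 0) →
      Tendsto g l (𝓝 0) → Tendsto (fun x => f x + g x) l (𝓝 0) := fun hf hg => by
    simpa using! hf.add hg
  have tsub : ∀ {W : Type} {l : Filter W} {f g : W → (Fin 3 → ℂ)}, Tendsto f l (𝓝 0) →
      Tendsto g l (𝓝 0) → Tendsto (fun x => f x - g x) l (𝓝 0) := fun hf hg => by
    simpa using! hf.sub hg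
  have t0 : ∀ {W : Type} {l : Filter W}, Tendsto (fun _ : W => (0 : ℂ)) l (𝓝 0) :=
    fun {_ _} => tendsto_const_nhds
  have tid : Tendsto (fun s : Fin 3 → ℂ => s) (𝓝 0) (𝓝 0) := tendsto_id
  have hgraph : ∀ᶠ s in 𝓝 (0 : Fin 3 → ℂ), s + I • h s = Q (0, 0, s - I • h s) ∧
      s - I • h s = Qb (0, 0, s + I • h s) := by
    filter_upwards [(tendsto_zero_pair tid th).eventually hhe,
      (tendsto_zero_pair (tendsto_zero_pair t0 (tadd tid (tI th)))
        (tendsto_zero_pair t0 (tsub tid (tI th)))).eventually dual] with s h1 h2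
    have h3 := sub_eq_zero.1 (h1.2 rfl)
    exact ⟨h3, h2.1.1 h3⟩
  -- conjugation
  have hQs : ∀ᶠ p in 𝓝 (0 : ℂ × ℂ × (Fin 3 → ℂ)),
      star (Q p) = Qb (star p.1, star p.2.1, star p.2.2) := by
    have ta : Tendsto (fun p : ℂ × ℂ × (Fin 3 → ℂ) => (((p.1, Q p), p.2) : CoordSpace × CoordSpace))
      (𝓝 0) (𝓝 0) :=
      tendsto_zero_pair (tendsto_zero_pair tendsto_zero_fst tQ) tendsto_zero_snd
    have tb : Tendsto (fun p : ℂ × ℂ × (Fin 3 → ℂ) =>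
        ((star p.2, star ((p.1, Q p) : CoordSpace)) : CoordSpace × CoordSpace)) (𝓝 0) (𝓝 0) :=
      tendsto_zero_pair (tendsto_zero_star tendsto_zero_snd)
        (tendsto_zero_star (tendsto_zero_pair tendsto_zero_fst tQ))
    filter_upwards [ta.eventually hrs, ta.eventually dual, tb.eventually dual] with p h1 h2 h3
    have h4 : r ((p.1, Q p), p.2) = 0 := h2.2.2 (h2.1.1 rfl)
    rw [h4, star_zero] at h1
    exact h3.2.1 h1
  -- Conjugating the equation for `h` gives its dual form at `star s`, solved by `star (h s)`;
  -- uniqueness in the implicit function theorem does the rest.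
  have hhs : ∀ᶠ s in 𝓝 (0 : Fin 3 → ℂ), star (h s) = h (star s) := by
    have tk : Tendsto (fun s : Fin 3 → ℂ => ((0, 0, s - I • h s) : ℂ × ℂ × (Fin 3 → ℂ)))
      (𝓝 0) (𝓝 0) := tendsto_zero_pair t0 (tendsto_zero_pair t0 (tsub tid (tI th)))
    have ts := tendsto_zero_star tid
    have ths := tendsto_zero_star th
    filter_upwards [hgraph, tk.eventually hQs, (tendsto_zero_pair ts ths).eventually hhe,
      (tendsto_zero_pair (tendsto_zero_pair t0 (tadd ts (tI ths)))
        (tendsto_zero_pair t0 (tsub ts (tI ths)))).eventually dual] with s h1 h2 h3 h4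
    rw [← h1.1] at h2
    refine h3.1 (sub_eq_zero.2 ?_)
    refine h4.1.2 ?_
    have e1 : star (s + I • h s) = star s - I • star (h s) := by
      ext; simp [sub_eq_add_neg]
    have e2 : star (s - I • h s) = star s + I • star (h s) := by
      ext; simp
    rw [e1] at h2
    simp only [e2, star_zero] at h2
    exact h2
  -- For fixed `s`, `Ψ (·, s)` parametrizes the Segre variety `ζ = 0`, `τ = s - i h(s)`, and `Ψ (0,
  -- s) = (0, s + i h(s))`. The map `Ψb` is its conjugate, which replaces `star ∘ Ψ` once the barred
  -- variables are independent.
  let Ψ : CoordSpace → CoordSpace := fun ξ => (ξ.1, Q (ξ.1, 0, ξ.2 - I • h ξ.2))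
  let Ψb : CoordSpace → CoordSpace := fun ξ => (ξ.1, Qb (ξ.1, 0, ξ.2 + I • h ξ.2))
  have hh2 : AnalyticAt ℂ (fun ξ : CoordSpace => h ξ.2) 0 :=
    analyticAt_comp_zero (g := fun ξ : CoordSpace => ξ.2) hh analyticAt_snd rfl
  -- One computation serves `Ψ` (`c = -I`) and `Ψb` (`c = I`). Since `h` has zero derivative and `q`
  -- has derivative `τ`, both maps are tangent to the identity.
  have hsgn : ∀ (c : ℂ) {q : ℂ × ℂ × (Fin 3 → ℂ) → (Fin 3 → ℂ)}, AnalyticAt ℂ q 0 → q 0 = 0 →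
      (∀ x, fderiv ℂ q 0 x = x.2.2) →
      AnalyticAt ℂ (fun ξ : CoordSpace => (ξ.1, q (ξ.1, 0, ξ.2 + c • h ξ.2))) 0 ∧
      ((0 : CoordSpace).1, q ((0 : CoordSpace).1, 0, (0 : CoordSpace).2 +
        c • h (0 : CoordSpace).2)) = 0 ∧
      ∀ v, fderiv ℂ (fun ξ : CoordSpace => (ξ.1, q (ξ.1, 0, ξ.2 + c • h ξ.2))) 0 v = v := by
    intro c q hq hq0 hqd
    have hch : AnalyticAt ℂ (fun ξ : CoordSpace => c • h ξ.2) 0 := hh2.const_smul (c := c)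
    have a1 : AnalyticAt ℂ (fun ξ : CoordSpace => ξ.2 + c • h ξ.2) 0 :=
      analyticAt_snd.add hch
    have a2 : AnalyticAt ℂ (fun ξ : CoordSpace => ((0 : ℂ), ξ.2 + c • h ξ.2)) 0 :=
      analyticAt_const.prod a1
    have a3 : AnalyticAt ℂ (fun ξ : CoordSpace => (ξ.1, (0 : ℂ), ξ.2 + c • h ξ.2)) 0 :=
      analyticAt_fst.prod a2
    have z3 : ((0 : CoordSpace).1, (0 : ℂ), (0 : CoordSpace).2 + c • h (0 : CoordSpace).2) = 0 := by
      simp [hh0]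
    have a4 := analyticAt_comp_zero hq a3 z3
    refine ⟨analyticAt_fst.prod a4, ?_, fun v => ?_⟩
    · rw [z3, hq0]; rfl
    · have hf : fderiv ℂ (fun ξ : CoordSpace => ξ.1) 0 v = v.1 :=
        IsLinearMap.fderiv_apply_of_finiteDimensional ⟨fun _ _ => rfl, fun _ _ => rfl⟩ _ _
      have hs : fderiv ℂ (fun ξ : CoordSpace => ξ.2) 0 v = v.2 :=
        IsLinearMap.fderiv_apply_of_finiteDimensional ⟨fun _ _ => rfl, fun _ _ => rfl⟩ _ _
      have hh2d : fderiv ℂ (fun ξ : CoordSpace => h ξ.2) 0 v = 0 := by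
        rw [fderiv_comp_zero (g := fun ξ : CoordSpace => ξ.2) hh analyticAt_snd rfl, hhd']
      rw [fderiv_pair_apply analyticAt_fst a4, fderiv_comp_zero hq a3 z3, hqd,
        fderiv_pair_apply analyticAt_fst a2, fderiv_pair_apply analyticAt_const a1,
        fderiv_fun_add (analyticAt_snd (𝕜 := ℂ)).differentiableAt
          hch.differentiableAt, fderiv_fun_const_smul hh2.differentiableAt]
      simp only [add_apply, smul_apply, hf, hs, hh2d, smul_zero, add_zero]
  have e1 : Ψ = fun ξ => (ξ.1, Q (ξ.1, 0, ξ.2 + (-I) • h ξ.2)) := by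
    simp only [Ψ, neg_smul, sub_eq_add_neg]
  obtain ⟨hΨ, hΨ0, hΨd⟩ : AnalyticAt ℂ Ψ 0 ∧ Ψ 0 = 0 ∧ ∀ v, fderiv ℂ Ψ 0 v = v := by
    rw [e1]; exact hsgn (-I) hQ hQ0 hQd'
  obtain ⟨hΨb, hΨb0, hΨbd⟩ : AnalyticAt ℂ Ψb 0 ∧ Ψb 0 = 0 ∧ ∀ v, fderiv ℂ Ψb 0 v = v :=
    hsgn I hQb hQb0 hQbd'
  have tΨ := tendsto_zero_of_analyticAt hΨ hΨ0
  have tΨb := tendsto_zero_of_analyticAt hΨb hΨb0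
  have hΨs : ∀ᶠ ξ in 𝓝 (0 : CoordSpace), star (Ψ ξ) = Ψb (star ξ) := by
    have ts2 : Tendsto (fun ξ : CoordSpace => ξ.2) (𝓝 0) (𝓝 0) := tendsto_zero_snd
    have t3 : Tendsto (fun ξ : CoordSpace => ((ξ.1, 0, ξ.2 - I • h ξ.2) : ℂ × ℂ × (Fin 3 → ℂ)))
      (𝓝 0) (𝓝 0) := tendsto_zero_pair tendsto_zero_fst (tendsto_zero_pair t0
        (tsub ts2 (tI (th.comp ts2))))
    filter_upwards [ts2.eventually hhs, t3.eventually hQs] with ξ h1 h2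
    refine Prod.ext rfl ?_
    change star (Q (ξ.1, 0, ξ.2 - I • h ξ.2)) = Qb (star ξ.1, 0, star ξ.2 + I • h (star ξ.2))
    rw [h2, ← h1]
    have e2 : star (ξ.2 - I • h ξ.2) = star ξ.2 + I • star (h ξ.2) := by
      ext; simp
    rw [e2, star_zero]
  have hpa : AnalyticAt ℂ (fun P : CoordSpace × CoordSpace => (Ψ P.1, Ψb P.2)) 0 :=
    (analyticAt_comp_zero (g := fun P : CoordSpace × CoordSpace => P.1) hΨ analyticAt_fst rfl).prod
      (analyticAt_comp_zero (g := fun P : CoordSpace × CoordSpace => P.2) hΨb analyticAt_snd rfl)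
  have hp0 : (Ψ (0 : CoordSpace × CoordSpace).1, Ψb (0 : CoordSpace × CoordSpace).2) = 0 :=
    Prod.ext hΨ0 hΨb0
  refine ⟨Ψ, fun P => r (Ψ P.1, Ψb P.2), hΨ, hΨ0, hΨd, analyticAt_comp_zero hr hpa hp0, ?_, ?_,
    fun P => ?_, ?_⟩
  · filter_upwards [hΨs] with ξ h1
    rw [h1]
  · have t1 : Tendsto (fun P : CoordSpace × CoordSpace => P.1) (𝓝 0) (𝓝 0) := tendsto_zero_fst
    have t2 : Tendsto (fun P : CoordSpace × CoordSpace => star P.2) (𝓝 0) (𝓝 0) :=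
      tendsto_zero_star tendsto_zero_snd
    filter_upwards [(tendsto_zero_of_analyticAt hpa hp0).eventually hrs, t1.eventually hΨs,
      t2.eventually hΨs] with P h1 h2 h3
    rw [← h1, h2]
    rw [star_star] at h3
    rw [← h3, star_star]
  · rw [fderiv_comp_zero hr hpa hp0, hrd, fderiv_pair_apply
      (analyticAt_comp_zero (g := fun P : CoordSpace × CoordSpace => P.1) hΨ analyticAt_fst rfl)
      (analyticAt_comp_zero (g := fun P : CoordSpace × CoordSpace => P.2) hΨb analyticAt_snd rfl),
      fderiv_comp_zero (g := fun P : CoordSpace × CoordSpace => P.1) hΨ analyticAt_fst rfl,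
      fderiv_comp_zero (g := fun P : CoordSpace × CoordSpace => P.2) hΨb analyticAt_snd rfl,
      hΨd, hΨbd]
    have hf : fderiv ℂ (fun P : CoordSpace × CoordSpace => P.1) 0 P = P.1 :=
      IsLinearMap.fderiv_apply_of_finiteDimensional ⟨fun _ _ => rfl, fun _ _ => rfl⟩ _ _
    have hs : fderiv ℂ (fun P : CoordSpace × CoordSpace => P.2) 0 P = P.2 :=
      IsLinearMap.fderiv_apply_of_finiteDimensional ⟨fun _ _ => rfl, fun _ _ => rfl⟩ _ _
    rw [hf, hs]
  · have ts2 : Tendsto (fun ξ : CoordSpace => ξ.2) (𝓝 0) (𝓝 0) := tendsto_zero_snd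
    have ta := tsub ts2 (tI (th.comp ts2))
    have tb := tadd ts2 (tI (th.comp ts2))
    filter_upwards [ts2.eventually hgraph,
      (tendsto_zero_pair tΨ (tendsto_zero_pair (t0 (W := CoordSpace)) ta)).eventually dual,
      (tendsto_zero_pair (tendsto_zero_pair (t0 (W := CoordSpace)) tb) tΨb).eventually dual]
      with ξ h1 h2 h3
    constructor
    -- The second point equals `(0, s - i h(s))`, and `Ψ ξ` was built by solving `r = 0` against
    -- exactly that point. The other identity is the dual one.
    · change r (Ψ ξ, (0, Qb (0, 0, ξ.2 + I • h ξ.2))) = 0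
      rw [← h1.2]
      exact h2.2.2 (h2.1.1 rfl)
    · change r ((0, Q (0, 0, ξ.2 - I • h ξ.2)), Ψb ξ) = 0
      rw [← h1.1]
      exact h3.2.2 rfl

end CRGeometry

/-! ### From complex to real graphs -/

namespace CRGeometry

open Complex Set Filter Topology Asymptotics

/-- The equation `s = Q(z, z̄, s̄)` of a submanifold in normal coordinates, with
`Q = s̄ + z z̄ q(z, z̄, s̄)`. -/
theorem exists_complex_graph {R : CoordSpace × CoordSpace → (Fin 3 → ℂ)}
    (hR : AnalyticAt ℂ R 0) (hR0 : R 0 = 0)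
    (hRd : ∀ P, fderiv ℂ R 0 P = (1 / (2 * I) : ℂ) • (P.1.2 - P.2.2))
    (hRn : ∀ᶠ ξ in 𝓝 (0 : CoordSpace), R (ξ, (0, ξ.2)) = 0 ∧ R ((0, ξ.2), ξ) = 0) :
    ∃ q : ℂ × ℂ × (Fin 3 → ℂ) → (Fin 3 → ℂ), AnalyticAt ℂ q 0 ∧
      ∀ᶠ P in 𝓝 (0 : CoordSpace × CoordSpace), R P = 0 ↔
        P.1.2 = P.2.2 + (P.1.1 * P.2.1) • q (P.1.1, P.2.1, P.2.2) := by
  have hI : (1 / (2 * I) : ℂ) ≠ 0 := by simp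
  let g1 : (ℂ × ℂ × (Fin 3 → ℂ)) × (Fin 3 → ℂ) → CoordSpace × CoordSpace :=
    fun p => ((p.1.1, p.2), (p.1.2.1, p.1.2.2))
  have hg1 : IsLinearMap ℂ g1 := ⟨fun _ _ => rfl, fun _ _ => rfl⟩
  have ha1 := hg1.analyticAt_of_finiteDimensional 0
  obtain ⟨Q, hQ, hQ0, hQe, -⟩ := exists_analyticAt_implicit
    (analyticAt_comp_zero hR ha1 hg1.map_zero) (by rw [hg1.map_zero, hR0]) hI
    (fun y => by
      rw [fderiv_comp_zero hR ha1 hg1.map_zero, hg1.fderiv_apply_of_finiteDimensional, hRd]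
      simp [g1])
  have tn : ∀ (g : ℂ × ℂ × (Fin 3 → ℂ) → ℂ × ℂ × (Fin 3 → ℂ)), Continuous g → g 0 = 0 →
      Tendsto g (𝓝 0) (𝓝 0) := fun g hg h0 => by
    have := hg.tendsto 0
    rwa [h0] at this
  have hz : ∀ᶠ p in 𝓝 (0 : ℂ × ℂ × (Fin 3 → ℂ)), Q (p.1, 0, p.2.2) = p.2.2 := by
    have t1 : Tendsto (fun p : ℂ × ℂ × (Fin 3 → ℂ) => ((p.1, p.2.2) : CoordSpace)) (𝓝 0) (𝓝 0) :=
      (by fun_prop : Continuous (fun p : ℂ × ℂ × (Fin 3 → ℂ) =>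
        ((p.1, p.2.2) : CoordSpace))).tendsto 0
    have t2 : Tendsto (fun p : ℂ × ℂ × (Fin 3 → ℂ) => (((p.1, 0, p.2.2), p.2.2) :
        (ℂ × ℂ × (Fin 3 → ℂ)) × (Fin 3 → ℂ))) (𝓝 0) (𝓝 0) :=
      (by fun_prop : Continuous (fun p : ℂ × ℂ × (Fin 3 → ℂ) => (((p.1, 0, p.2.2), p.2.2) :
        (ℂ × ℂ × (Fin 3 → ℂ)) × (Fin 3 → ℂ)))).tendsto 0
    filter_upwards [t1.eventually hRn, t2.eventually hQe] with p h1 h2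
    exact (h2.1 h1.1).symm
  have hζ : ∀ᶠ p in 𝓝 (0 : ℂ × ℂ × (Fin 3 → ℂ)), Q (0, p.2.1, p.2.2) = p.2.2 := by
    have t1 : Tendsto (fun p : ℂ × ℂ × (Fin 3 → ℂ) => p.2) (𝓝 0) (𝓝 0) := tendsto_zero_snd
    have t2 : Tendsto (fun p : ℂ × ℂ × (Fin 3 → ℂ) => (((0, p.2.1, p.2.2), p.2.2) :
        (ℂ × ℂ × (Fin 3 → ℂ)) × (Fin 3 → ℂ))) (𝓝 0) (𝓝 0) :=
      (by fun_prop : Continuous (fun p : ℂ × ℂ × (Fin 3 → ℂ) => (((0, p.2.1, p.2.2), p.2.2) :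
        (ℂ × ℂ × (Fin 3 → ℂ)) × (Fin 3 → ℂ)))).tendsto 0
    filter_upwards [t1.eventually hRn, t2.eventually hQe] with p h1 h2
    exact (h2.1 h1.2).symm
  have hf : AnalyticAt ℂ (fun p : ℂ × ℂ × (Fin 3 → ℂ) => Q p - p.2.2) 0 :=
    hQ.sub (analyticAt_snd.comp analyticAt_snd)
  -- `Q - τ` vanishes on `z = 0` and on `ζ = 0`; it is divided by `z`, then by `ζ`.
  obtain ⟨g, hg, hge⟩ := exists_analyticAt_smul_eq_sub hf
    (ContinuousLinearMap.fst ℂ ℂ (ℂ × (Fin 3 → ℂ))) (1, 0, 0)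
  obtain ⟨q, hq, hqe⟩ := exists_analyticAt_smul_eq_sub hg
    ((ContinuousLinearMap.fst ℂ ℂ (Fin 3 → ℂ)).comp (ContinuousLinearMap.snd ℂ ℂ (ℂ × (Fin 3 → ℂ))))
    (0, 1, 0)
  have hQq : ∀ᶠ p in 𝓝 (0 : ℂ × ℂ × (Fin 3 → ℂ)), Q p = p.2.2 + (p.1 * p.2.1) • q p := by
    have t1 := tn (fun p => (p.1, 0, p.2.2)) (by fun_prop) rfl
    filter_upwards [hge, t1.eventually hge, hqe, hz, hζ, t1.eventually hζ]
      with p h1 h2 h3 h4 h5 h6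
    have e1 : p - p.1 • ((1, 0, 0) : ℂ × ℂ × (Fin 3 → ℂ)) = (0, p.2.1, p.2.2) := by
      ext <;> simp
    have e2 : p - p.2.1 • ((0, 1, 0) : ℂ × ℂ × (Fin 3 → ℂ)) = (p.1, 0, p.2.2) := by
      ext <;> simp
    have e3 : ((p.1, 0, p.2.2) : ℂ × ℂ × (Fin 3 → ℂ)) - p.1 • ((1, 0, 0) : ℂ × ℂ × (Fin 3 → ℂ)) =
      (0, 0, p.2.2) := by ext <;> simp
    simp only [ContinuousLinearMap.coe_fst', ContinuousLinearMap.comp_apply,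
      ContinuousLinearMap.coe_snd', e1, e2, e3, h4, h5, sub_self, sub_zero] at h1 h2 h3
    rw [sub_eq_zero.2 h6, sub_zero] at h2
    -- The quotient `g` need not be shown to vanish on `ζ = 0`: only `z • g(z, 0, τ) = 0` is used,
    -- which is the first division restricted to `ζ = 0`.
    rw [mul_smul, ← h3, smul_sub, ← h1, ← h2]
    abel
  refine ⟨q, hq, ?_⟩
  have t1 : Tendsto (fun P : CoordSpace × CoordSpace => ((P.1.1, P.2.1, P.2.2), P.1.2))
      (𝓝 0) (𝓝 0) :=
    (by fun_prop : Continuous (fun P : CoordSpace × CoordSpace =>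
      ((P.1.1, P.2.1, P.2.2), P.1.2))).tendsto 0
  have t2 : Tendsto (fun P : CoordSpace × CoordSpace => (P.1.1, P.2.1, P.2.2))
      (𝓝 0) (𝓝 0) :=
    (by fun_prop : Continuous (fun P : CoordSpace × CoordSpace =>
      (P.1.1, P.2.1, P.2.2))).tendsto 0
  filter_upwards [t1.eventually hQe, t2.eventually hQq] with P h1 h2
  rw [← h2]
  exact h1

/-- From the equation `s = s̄ + z z̄ q(z, z̄, s̄)` to a real graph `Im s = z z̄ ψ(z, z̄, Re s)`. -/
theorem exists_real_graph {R : CoordSpace × CoordSpace → (Fin 3 → ℂ)}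
    (hRs : ∀ᶠ P in 𝓝 (0 : CoordSpace × CoordSpace), R (star P.2, star P.1) = star (R P))
    {q : ℂ × ℂ × (Fin 3 → ℂ) → (Fin 3 → ℂ)} (hq : AnalyticAt ℂ q 0)
    (hRq : ∀ᶠ P in 𝓝 (0 : CoordSpace × CoordSpace), R P = 0 ↔
        P.1.2 = P.2.2 + (P.1.1 * P.2.1) • q (P.1.1, P.2.1, P.2.2)) :
    ∃ ψ : ℂ × ℂ × (Fin 3 → ℂ) → (Fin 3 → ℂ), AnalyticAt ℂ ψ 0 ∧
      ψ 0 = (1 / (2 * I) : ℂ) • q 0 ∧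
      (∀ v, fderiv ℂ ψ 0 v = (1 / (2 * I) : ℂ) • fderiv ℂ q 0 v) ∧
      (∀ᶠ x in 𝓝 (0 : ℂ × (Fin 3 → ℝ)), star (ψ (x.1, star x.1, fun j => (x.2 j : ℂ))) =
        ψ (x.1, star x.1, fun j => (x.2 j : ℂ))) ∧
      ∀ᶠ ξ in 𝓝 (0 : CoordSpace), R (ξ, star ξ) = 0 ↔ (fun j => ((ξ.2 j).im : ℂ)) =
        (ξ.1 * star ξ.1) • ψ (ξ.1, star ξ.1, fun j => ((ξ.2 j).re : ℂ)) := by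
  -- Substituting `s = u + iv`, `τ = u - iv` gives `2i v = zζ q(z, ζ, u - iv)`, to be solved for `v
  -- = g(z, ζ, u)`. Then `ψ = q(z, ζ, u - i g)/(2i)`.
  let k : (ℂ × ℂ × (Fin 3 → ℂ)) × (Fin 3 → ℂ) → ℂ × ℂ × (Fin 3 → ℂ) :=
    fun p => (p.1.1, p.1.2.1, p.1.2.2 - I • p.2)
  have hk : IsLinearMap ℂ k := by
    constructor
    · intro x y; ext <;> simp [k]; ring
    · intro c x; ext <;> simp [k]; ring
  have hqk : AnalyticAt ℂ (fun p => q (k p)) 0 :=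
    analyticAt_comp_zero hq (hk.analyticAt_of_finiteDimensional 0) hk.map_zero
  let m : (ℂ × ℂ × (Fin 3 → ℂ)) × (Fin 3 → ℂ) → ℂ := fun p => (1 / (2 * I) : ℂ) * (p.1.1 * p.1.2.1)
  have hm1 : AnalyticAt ℂ (fun p : (ℂ × ℂ × (Fin 3 → ℂ)) × (Fin 3 → ℂ) => p.1.1) 0 :=
    IsLinearMap.analyticAt_of_finiteDimensional ⟨fun _ _ => rfl, fun _ _ => rfl⟩ _
  have hm2 : AnalyticAt ℂ (fun p : (ℂ × ℂ × (Fin 3 → ℂ)) × (Fin 3 → ℂ) => p.1.2.1) 0 :=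
    IsLinearMap.analyticAt_of_finiteDimensional ⟨fun _ _ => rfl, fun _ _ => rfl⟩ _
  have hm : AnalyticAt ℂ m 0 := analyticAt_const.mul (hm1.mul hm2)
  -- Since `zζ` has no first-order part, `g` has zero derivative; this is why `ψ` inherits the 1-jet
  -- of `q/(2i)`.
  have hmd : fderiv ℂ m 0 = 0 := by
    have h1 := (hm1.differentiableAt.hasFDerivAt.mul hm2.differentiableAt.hasFDerivAt).const_mul
      (1 / (2 * I) : ℂ)
    have h2 : fderiv ℂ m 0 = _ := h1.fderiv
    rw [h2]
    ext <;> simp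
  have hf : AnalyticAt ℂ (fun p : (ℂ × ℂ × (Fin 3 → ℂ)) × (Fin 3 → ℂ) => p.2 - m p • q (k p)) 0 :=
    analyticAt_snd.sub (hm.smul hqk)
  have hfd : ∀ v, fderiv ℂ (fun p : (ℂ × ℂ × (Fin 3 → ℂ)) × (Fin 3 → ℂ) => p.2 - m p • q (k p)) 0 v
      = (1 : ℂ) • v.2 := by
    intro v
    have h1 := (hasFDerivAt_snd (𝕜 := ℂ) (p := (0 : (ℂ × ℂ × (Fin 3 → ℂ)) × (Fin 3 → ℂ)))).sub
      (hm.differentiableAt.hasFDerivAt.smul hqk.differentiableAt.hasFDerivAt)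
    have h2 : fderiv ℂ (fun p : (ℂ × ℂ × (Fin 3 → ℂ)) × (Fin 3 → ℂ) => p.2 - m p • q (k p)) 0 = _ :=
      h1.fderiv
    rw [h2, hmd]
    simp [m]
  obtain ⟨g, hg, hg0, hge, hgd⟩ := exists_analyticAt_implicit hf (by simp [m]) one_ne_zero
    (fun y => hfd (0, y))
  have hgd' : ∀ x, fderiv ℂ g 0 x = 0 := fun x => by simpa [hfd] using hgd x
  have hl : AnalyticAt ℂ (fun p => k (p, g p)) 0 :=
    analyticAt_comp_zero (hk.analyticAt_of_finiteDimensional 0) (analyticAt_id.prod hg)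
      (Prod.ext rfl hg0)
  have hl0 : k ((0 : ℂ × ℂ × (Fin 3 → ℂ)), g 0) = 0 := by
    rw [hg0]; exact hk.map_zero
  have hψ : AnalyticAt ℂ (fun p => (1 / (2 * I) : ℂ) • q (k (p, g p))) 0 :=
    (analyticAt_comp_zero hq hl hl0).const_smul (c := (1 / (2 * I) : ℂ))
  set ψ := fun p => (1 / (2 * I) : ℂ) • q (k (p, g p)) with hψdef
  have tg := tendsto_zero_of_analyticAt hg hg0
  have hgψ : ∀ᶠ p in 𝓝 (0 : ℂ × ℂ × (Fin 3 → ℂ)), g p = (p.1 * p.2.1) • ψ p := by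
    have tid : Tendsto (fun p : ℂ × ℂ × (Fin 3 → ℂ) => p) (𝓝 0) (𝓝 0) := tendsto_id
    filter_upwards [(tendsto_zero_pair tid tg).eventually hge] with p h1
    have h2 := sub_eq_zero.1 (h1.2 rfl)
    rw [h2, hψdef, smul_smul, mul_comm (p.1 * p.2.1)]
  -- the equation in terms of the real and imaginary parts
  have hiff : ∀ᶠ p in 𝓝 (0 : (ℂ × ℂ × (Fin 3 → ℂ)) × (Fin 3 → ℂ)),
      (R ((p.1.1, p.1.2.2 + I • p.2), (p.1.2.1, p.1.2.2 - I • p.2)) = 0 ↔ p.2 = g p.1) := by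
    have t1 : Tendsto (fun p : (ℂ × ℂ × (Fin 3 → ℂ)) × (Fin 3 → ℂ) =>
        (((p.1.1, p.1.2.2 + I • p.2), (p.1.2.1, p.1.2.2 - I • p.2)) : CoordSpace × CoordSpace))
        (𝓝 0) (𝓝 0) := by
      have := (by fun_prop : Continuous (fun p : (ℂ × ℂ × (Fin 3 → ℂ)) × (Fin 3 → ℂ) =>
        (((p.1.1, p.1.2.2 + I • p.2), (p.1.2.1, p.1.2.2 - I • p.2)) :
          CoordSpace × CoordSpace))).tendsto 0
      simpa using! this
    filter_upwards [t1.eventually hRq, hge] with p h1 h2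
    rw [h1, ← h2, sub_eq_zero]
    have h2I : (2 * I : ℂ) ≠ 0 := by simp
    have e1 : p.2 = m p • q (k p) ↔ (2 * I) • p.2 = (p.1.1 * p.1.2.1) • q (k p) := by
      simp only [m]
      rw [mul_smul, one_div, eq_inv_smul_iff₀ h2I]
    rw [e1]
    change p.1.2.2 + I • p.2 = p.1.2.2 - I • p.2 + (p.1.1 * p.1.2.1) • q (k p) ↔ _
    have e2 : (2 * I) • p.2 = I • p.2 + I • p.2 := by
      rw [← add_smul]; congr 1; ring
    rw [e2, sub_add_eq_add_sub, eq_sub_iff_add_eq, add_assoc, add_right_inj]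
  have hreal : ∀ᶠ x in 𝓝 (0 : ℂ × (Fin 3 → ℝ)), star (g (x.1, star x.1, fun j => (x.2 j : ℂ))) =
        g (x.1, star x.1, fun j => (x.2 j : ℂ)) := by
    have tc : Tendsto (fun x : ℂ × (Fin 3 → ℝ) =>
        ((x.1, star x.1, fun j => (x.2 j : ℂ)) : ℂ × ℂ × (Fin 3 → ℂ))) (𝓝 0) (𝓝 0) := by
      have := (by fun_prop : Continuous (fun x : ℂ × (Fin 3 → ℝ) =>
        ((x.1, star x.1, fun j => (x.2 j : ℂ)) : ℂ × ℂ × (Fin 3 → ℂ)))).tendsto 0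
      convert this using 2
      ext <;> simp
    have t1 := tendsto_zero_pair tc (tg.comp tc)
    have t2 := tendsto_zero_pair tc (tendsto_zero_star (tg.comp tc))
    have t3 : Tendsto (fun p : (ℂ × ℂ × (Fin 3 → ℂ)) × (Fin 3 → ℂ) =>
        (((p.1.1, p.1.2.2 + I • p.2), (p.1.2.1, p.1.2.2 - I • p.2)) : CoordSpace × CoordSpace))
        (𝓝 0) (𝓝 0) := by
      have := (by fun_prop : Continuous (fun p : (ℂ × ℂ × (Fin 3 → ℂ)) × (Fin 3 → ℂ) =>
        (((p.1.1, p.1.2.2 + I • p.2), (p.1.2.1, p.1.2.2 - I • p.2)) :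
          CoordSpace × CoordSpace))).tendsto 0
      simpa using! this
    filter_upwards [t1.eventually hiff, t2.eventually hiff, (t3.comp t1).eventually hRs]
      with x h1 h2 h3
    refine h2.1 ?_
    have h4 := h1.2 rfl
    have h5 : star (R ((x.1, (fun j => (x.2 j : ℂ)) + I • g (x.1, star x.1, fun j => (x.2 j : ℂ))),
      (star x.1, (fun j => (x.2 j : ℂ)) - I • g (x.1, star x.1, fun j => (x.2 j : ℂ))))) = 0 := by
      rw [← star_zero]; exact congrArg star h4
    refine Eq.trans (congrArg R ?_) (h3.trans h5)
    ext <;> simp [sub_eq_add_neg]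
  refine ⟨ψ, hψ, ?_, fun v => ?_, ?_, ?_⟩
  · simp only [hψdef, hl0]
  · rw [hψdef, fderiv_fun_const_smul (analyticAt_comp_zero hq hl hl0).differentiableAt, smul_apply,
      fderiv_comp_zero hq hl hl0, fderiv_comp_zero (g := fun p => (p, g p))
      (hk.analyticAt_of_finiteDimensional 0) (analyticAt_id.prod hg) (Prod.ext rfl hg0),
      hk.fderiv_apply_of_finiteDimensional, fderiv_pair_apply (f := fun p => p) analyticAt_id hg, hgd']
    simp [k]
  · have tc : Tendsto (fun x : ℂ × (Fin 3 → ℝ) =>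
        ((x.1, star x.1, fun j => (x.2 j : ℂ)) : ℂ × ℂ × (Fin 3 → ℂ))) (𝓝 0) (𝓝 0) := by
      have := (by fun_prop : Continuous (fun x : ℂ × (Fin 3 → ℝ) =>
        ((x.1, star x.1, fun j => (x.2 j : ℂ)) : ℂ × ℂ × (Fin 3 → ℂ)))).tendsto 0
      convert this using 2
      ext <;> simp
    let D : ℂ × (Fin 3 → ℝ) → (Fin 3 → ℂ) := fun x =>
      star (ψ (x.1, star x.1, fun j => (x.2 j : ℂ))) - ψ (x.1, star x.1, fun j => (x.2 j : ℂ))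
    -- Reality of `g = z z̄ ψ` gives that of `ψ` only where `z ≠ 0`; continuity extends it across `z
    -- = 0`.
    have h1 : ∀ᶠ x in 𝓝 (0 : ℂ × (Fin 3 → ℝ)), x.1 ≠ 0 → D x = 0 := by
      filter_upwards [hreal, tc.eventually hgψ] with x h1 h2 hx
      rw [h2, star_smul] at h1
      have e : star (x.1 * star x.1) = x.1 * star x.1 := by simp [mul_comm]
      simp only [e] at h1
      have hne : x.1 * star x.1 ≠ 0 := mul_ne_zero hx (star_ne_zero.2 hx)
      exact sub_eq_zero.2 (smul_right_injective _ hne h1)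
    have h2 : ∀ᶠ x in 𝓝 (0 : ℂ × (Fin 3 → ℝ)), ContinuousAt D x := by
      have hev := tc.eventually hψ.eventually_analyticAt
      filter_upwards [hev] with x hx
      have hc : ContinuousAt (fun x : ℂ × (Fin 3 → ℝ) =>
          ψ (x.1, star x.1, fun j => (x.2 j : ℂ))) x := by
        refine ContinuousAt.comp (g := ψ) (f := fun x : ℂ × (Fin 3 → ℝ) =>
          ((x.1, star x.1, fun j => (x.2 j : ℂ)) : ℂ × ℂ × (Fin 3 → ℂ))) hx.continuousAt ?_
        exact (by fun_prop : Continuous _).continuousAt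
      exact hc.star.sub hc
    filter_upwards [eventually_eventually_nhds.2 h1, h2] with x h1 h2
    rw [← sub_eq_zero]
    change D x = 0
    have t : Tendsto (fun w : ℂ => (w, x.2)) (𝓝[≠] x.1) (𝓝 x) :=
      ((by fun_prop : Continuous (fun w : ℂ => (w, x.2))).tendsto x.1).mono_left nhdsWithin_le_nhds
    have t1 : Tendsto (fun w : ℂ => D (w, x.2)) (𝓝[≠] x.1) (𝓝 (D x)) := h2.tendsto.comp t
    have hne : ∀ᶠ w in 𝓝[≠] x.1, w ≠ 0 := by
      rcases eq_or_ne x.1 0 with h | h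
      · rw [h]; exact self_mem_nhdsWithin
      · exact nhdsWithin_le_nhds (isOpen_ne.mem_nhds h)
    refine tendsto_nhds_unique (t1.congr' ?_) tendsto_const_nhds
    filter_upwards [t.eventually h1, hne] with w hw hw0
    exact hw hw0
  · have t1 : Tendsto (fun ξ : CoordSpace => (((ξ.1, star ξ.1, fun j => ((ξ.2 j).re : ℂ)),
        fun j => ((ξ.2 j).im : ℂ)) : (ℂ × ℂ × (Fin 3 → ℂ)) × (Fin 3 → ℂ))) (𝓝 0) (𝓝 0) := by
      have := (by fun_prop : Continuous (fun ξ : CoordSpace =>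
        (((ξ.1, star ξ.1, fun j => ((ξ.2 j).re : ℂ)),
        fun j => ((ξ.2 j).im : ℂ)) : (ℂ × ℂ × (Fin 3 → ℂ)) × (Fin 3 → ℂ)))).tendsto 0
      convert this using 2
      ext <;> simp
    have t2 : Tendsto (fun ξ : CoordSpace => ((ξ.1, star ξ.1, fun j => ((ξ.2 j).re : ℂ)) :
        ℂ × ℂ × (Fin 3 → ℂ))) (𝓝 0) (𝓝 0) := tendsto_zero_fst.comp t1
    filter_upwards [t1.eventually hiff, t2.eventually hgψ] with ξ h1 h2
    rw [← h2, ← h1]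
    have e1 : ξ.2 = (fun j => ((ξ.2 j).re : ℂ)) + I • fun j => ((ξ.2 j).im : ℂ) := by
      ext j; simp [mul_comm I, re_add_im]
    have e2 : star ξ.2 = (fun j => ((ξ.2 j).re : ℂ)) - I • fun j => ((ξ.2 j).im : ℂ) := by
      ext j
      apply Complex.ext <;> simp
    have e3 : ((ξ, star ξ) : CoordSpace × CoordSpace) = ((ξ.1, (fun j => ((ξ.2 j).re : ℂ)) +
        I • fun j => ((ξ.2 j).im : ℂ)), (star ξ.1, (fun j => ((ξ.2 j).re : ℂ)) -
        I • fun j => ((ξ.2 j).im : ℂ))) := by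
      rw [← e1, ← e2]; rfl
    rw [e3]

end CRGeometry

/-! ### Brackets on the coordinate functions, and tangency -/

namespace CRGeometry

open Complex Set Filter Topology Asymptotics

/-- The action of the five fields `L`, `L̄`, `[L, L̄]`, `[L, [L, L̄]]`, `[L̄, [L, L̄]]` on a function
`s` with `L s = z̄ κ` and `L̄ s = 0`. -/
theorem derivAlong_fiveFields {n : ℕ} {F : Type*} [NormedAddCommGroup F] [NormedSpace ℂ F]
    [CompleteSpace F] {L : (Fin n → ℂ) → CVec n} {s κ : (Fin n → ℂ) → F} {zb : (Fin n → ℂ) → ℂ}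
    {p : Fin n → ℂ} (hL : AnalyticAt ℝ L p) (hs : AnalyticAt ℝ s p) (hκ : AnalyticAt ℝ κ p)
    (hz : AnalyticAt ℝ zb p) (hz0 : zb p = 0)
    (hLs : ∀ᶠ x in 𝓝 p, derivAlong s x (L x) = zb x • κ x)
    (hLbs : ∀ᶠ x in 𝓝 p, derivAlong s x (conjField L x) = 0)
    (hLz : ∀ᶠ x in 𝓝 p, derivAlong zb x (L x) = 0)
    (hLbz : ∀ᶠ x in 𝓝 p, derivAlong zb x (conjField L x) = 1) (i : Fin 5) :
    derivAlong s p (fiveFields L i p) = ![0, 0, -κ p, -derivAlong κ p (L p),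
      -((2 : ℂ) • derivAlong κ p (conjField L p))] i := by
  have hLb := analyticAt_conjField hL
  have hB := analyticAt_bracket hL hLb
  have c2 : ∀ {g : (Fin n → ℂ) → F} {x}, AnalyticAt ℝ g x → ContDiffAt ℝ 2 g x :=
    fun h => h.contDiffAt
  set f : (Fin n → ℂ) → F := fun x => zb x • κ x with hf
  have hfa : AnalyticAt ℝ f p := hz.smul hκ
  have hLκ : AnalyticAt ℝ (fun x => derivAlong κ x (L x)) p := analyticAt_derivAlong hκ hL
  have hLbκ : AnalyticAt ℝ (fun x => derivAlong κ x (conjField L x)) p :=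
    analyticAt_derivAlong hκ hLb
  have hLf : ∀ᶠ x in 𝓝 p, derivAlong f x (L x) = zb x • derivAlong κ x (L x) := by
    filter_upwards [hLz, hz.eventually_analyticAt, hκ.eventually_analyticAt] with x h1 h2 h3
    rw [hf, derivAlong_smul h2.differentiableAt h3.differentiableAt, h1, zero_smul, zero_add]
  have hLbf : ∀ᶠ x in 𝓝 p, derivAlong f x (conjField L x) =
      κ x + zb x • derivAlong κ x (conjField L x) := by
    filter_upwards [hLbz, hz.eventually_analyticAt, hκ.eventually_analyticAt] with x h1 h2 h3
    rw [hf, derivAlong_smul h2.differentiableAt h3.differentiableAt, h1, one_smul]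
  have hBs : ∀ᶠ x in 𝓝 p, derivAlong s x (bracket L (conjField L) x) =
      -(κ x + zb x • derivAlong κ x (conjField L x)) := by
    filter_upwards [hLbf, hLs.eventually_nhds, hLbs.eventually_nhds, hs.eventually_analyticAt,
      hL.eventually_analyticAt, hLb.eventually_analyticAt] with x h1 h2 h3 h4 h5 h6
    rw [derivAlong_bracket (c2 h4) h5.differentiableAt h6.differentiableAt, derivAlong_congr h2,
      derivAlong_congr h3, derivAlong_fun_zero, zero_sub, ← h1]
  have dz := hz.differentiableAt
  have hzL : DifferentiableAt ℝ (fun x => zb x • derivAlong κ x (conjField L x)) p :=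
    (hz.smul hLbκ).differentiableAt
  have hLLbf : derivAlong (fun x => derivAlong f x (conjField L x)) p (L p) =
      derivAlong κ p (L p) := by
    rw [derivAlong_congr hLbf, derivAlong_add hκ.differentiableAt
      hzL, derivAlong_smul dz hLbκ.differentiableAt,
      hLz.self_of_nhds, hz0]
    simp
  have hLbLf : derivAlong (fun x => derivAlong f x (L x)) p (conjField L p) =
      derivAlong κ p (L p) := by
    rw [derivAlong_congr hLf, derivAlong_smul dz hLκ.differentiableAt,
      hLbz.self_of_nhds, hz0]
    simp
  -- The factor two: `L̄ (z̄ κ) = κ + z̄ L̄κ`, and applying `L̄` again produces `L̄κ` once from each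
  -- summand at a point where `z̄ = 0`.
  have hLbLbf : derivAlong (fun x => derivAlong f x (conjField L x)) p (conjField L p) =
      (2 : ℂ) • derivAlong κ p (conjField L p) := by
    rw [derivAlong_congr hLbf, derivAlong_add hκ.differentiableAt
      hzL, derivAlong_smul dz hLbκ.differentiableAt,
      hLbz.self_of_nhds, hz0, two_smul]
    simp
  -- Both `L L̄ f` and `L̄ L f` equal `Lκ` at `p`, so the term `[L, L̄](L s)` drops out of the
  -- third-order bracket.
  have hBf : derivAlong f p (bracket L (conjField L) p) = 0 := by
    rw [derivAlong_bracket (c2 hfa) hL.differentiableAt hLb.differentiableAt, hLLbf, hLbLf,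
      sub_self]
  have hBs' : (fun x => derivAlong s x (bracket L (conjField L) x)) =ᶠ[𝓝 p]
      fun x => -derivAlong f x (conjField L x) := by
    filter_upwards [hBs, hLbf] with x h1 h2
    rw [h1, h2]
  fin_cases i
  · change derivAlong s p (L p) = 0
    rw [hLs.self_of_nhds, hz0, zero_smul]
  · exact hLbs.self_of_nhds
  · change derivAlong s p (bracket L (conjField L) p) = -κ p
    rw [hBs.self_of_nhds, hz0, zero_smul, add_zero]
  · change derivAlong s p (bracket L (bracket L (conjField L)) p) = -derivAlong κ p (L p)
    rw [derivAlong_bracket (c2 hs) hL.differentiableAt hB.differentiableAt,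
      derivAlong_congr hBs', derivAlong_neg, hLLbf, derivAlong_congr hLs, hBf, sub_zero]
  · change derivAlong s p (bracket (conjField L) (bracket L (conjField L)) p) = _
    rw [derivAlong_bracket (c2 hs) hLb.differentiableAt hB.differentiableAt,
      derivAlong_congr hBs', derivAlong_neg, hLbLbf, derivAlong_congr hLbs, derivAlong_fun_zero,
      sub_zero]
    rfl

/-- Membership in the complexified tangent space through a complexified defining function. -/
theorem mem_complexTangent_iff {n c : ℕ} {M U : Set (Fin n → ℂ)} {ρ : (Fin n → ℂ) → (Fin c → ℝ)}
    {p : Fin n → ℂ} (hU : IsOpen U) (hM : M ∩ U = {q ∈ U | ρ q = 0}) (hp : p ∈ M ∩ U)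
    (hρ : AnalyticAt ℝ ρ p) (hs : Function.Surjective (fderiv ℝ ρ p)) (v : CVec n) :
    v ∈ complexTangent M p ↔ derivAlong (fun x j => (ρ x j : ℂ)) p v = 0 := by
  have h1 := tangentVectors_eq_ker hU hM hp hρ hs
  have h2 : HasFDerivAt (fun x j => (ρ x j : ℂ))
      ((ContinuousLinearMap.pi fun j => ofRealCLM.comp ((ContinuousLinearMap.proj
        (R := ℝ) (φ := fun _ : Fin c => ℝ) j).comp (fderiv ℝ ρ p)))) p := by
    refine hasFDerivAt_pi.2 fun j => ?_
    exact ofRealCLM.hasFDerivAt.comp p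
      (((ContinuousLinearMap.proj (R := ℝ) (φ := fun _ : Fin c => ℝ) j).hasFDerivAt).comp
        p hρ.differentiableAt.hasFDerivAt)
  have h3 : fderiv ℝ (fun x j => (ρ x j : ℂ)) p = _ := h2.fderiv
  have h4 : ∀ j, derivAlong (fun x j => (ρ x j : ℂ)) p v j =
      (fderiv ℝ ρ p (rePart v) j : ℂ) + I * (fderiv ℝ ρ p (imPart v) j : ℂ) := by
    intro j
    rw [derivAlong, h3]
    rfl
  simp only [complexTangent, h1, mem_ofPred_eq]
  constructor
  · rintro ⟨h5, h6⟩
    ext j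
    rw [h4, h5, h6]
    simp
  · intro h
    have h7 : ∀ j, fderiv ℝ ρ p (rePart v) j = 0 ∧ fderiv ℝ ρ p (imPart v) j = 0 := by
      intro j
      have := congrFun h j
      rw [h4] at this
      have h8 := congrArg re this
      have h9 := congrArg im this
      simp at h8 h9
      exact ⟨h8, h9⟩
    exact ⟨funext fun j => (h7 j).1, funext fun j => (h7 j).2⟩

theorem fderiv_symm_comp {X Y : Type*} [NormedAddCommGroup X] [NormedSpace ℂ X]
    [NormedAddCommGroup Y] [NormedSpace ℂ Y] (Φ : OpenPartialHomeomorph X Y) {x : X}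
    (hx : x ∈ Φ.source) (h1 : AnalyticAt ℂ Φ x) (h2 : AnalyticAt ℂ Φ.symm (Φ x)) (v : X) :
    fderiv ℂ Φ.symm (Φ x) (fderiv ℂ Φ x v) = v := by
  have h3 := h2.differentiableAt.hasFDerivAt.comp x h1.differentiableAt.hasFDerivAt
  have h4 : (Φ.symm ∘ Φ) =ᶠ[𝓝 x] id := by
    filter_upwards [Φ.open_source.mem_nhds hx] with y hy
    exact Φ.left_inv hy
  have h5 := (h3.congr_of_eventuallyEq h4.symm).unique (hasFDerivAt_id x)
  exact DFunLike.congr_fun h5 v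

theorem fderiv_comp_symm {X Y : Type*} [NormedAddCommGroup X] [NormedSpace ℂ X]
    [NormedAddCommGroup Y] [NormedSpace ℂ Y] (Φ : OpenPartialHomeomorph X Y) {x : X}
    (hx : x ∈ Φ.source) (h1 : AnalyticAt ℂ Φ x) (h2 : AnalyticAt ℂ Φ.symm (Φ x)) (v : Y) :
    fderiv ℂ Φ x (fderiv ℂ Φ.symm (Φ x) v) = v := by
  have h := fderiv_symm_comp Φ.symm (Φ.map_source hx) h2 (by
    rw [Φ.left_inv hx]; exact h1) v
  rw [Φ.left_inv hx] at h
  exact h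

/-- The derivative of a complexified defining function is injective on the `w`-directions. -/
theorem eventually_injective_fderiv {R : CoordSpace × CoordSpace → (Fin 3 → ℂ)}
    (hR : AnalyticAt ℂ R 0)
    (hRd : ∀ P, fderiv ℂ R 0 P = (1 / (2 * I) : ℂ) • (P.1.2 - P.2.2)) :
    ∀ᶠ P in 𝓝 (0 : CoordSpace × CoordSpace), ∀ β : Fin 3 → ℂ,
      fderiv ℂ R P ((0, β), 0) = 0 → β = 0 := by
  let ι : (Fin 3 → ℂ) →L[ℂ] CoordSpace × CoordSpace :=
    (ContinuousLinearMap.inl ℂ CoordSpace CoordSpace).comp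
      (ContinuousLinearMap.inr ℂ ℂ (Fin 3 → ℂ))
  have hc : ContinuousAt (fun P => (fderiv ℂ R P).comp ι) 0 := by
    have h1 : ContinuousAt (fderiv ℂ R) 0 := hR.fderiv.continuousAt
    exact h1.clm_comp continuousAt_const
  have h0 : (fderiv ℂ R 0).comp ι = (1 / (2 * I) : ℂ) • (1 : (Fin 3 → ℂ) →L[ℂ] (Fin 3 → ℂ)) := by
    refine ContinuousLinearMap.ext fun β => ?_
    rw [ContinuousLinearMap.comp_apply, hRd]
    simp [ι]
  have hu : IsUnit ((fderiv ℂ R 0).comp ι) := by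
    rw [h0]
    have : (1 / (2 * I) : ℂ) ≠ 0 := by simp
    refine ⟨⟨_, (1 / (2 * I) : ℂ)⁻¹ • (1 : (Fin 3 → ℂ) →L[ℂ] (Fin 3 → ℂ)), ?_, ?_⟩, rfl⟩
    · exact ContinuousLinearMap.ext fun β => smul_inv_smul₀ this β
    · exact ContinuousLinearMap.ext fun β => inv_smul_smul₀ this β
  -- At the origin the restricted derivative is a nonzero scalar, and invertibility is an open
  -- condition.
  filter_upwards [hc.eventually (Units.isOpen.mem_nhds hu)] with P hP β hβ
  obtain ⟨u, hu⟩ := hP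
  have h1 : (u : (Fin 3 → ℂ) →L[ℂ] (Fin 3 → ℂ)) β = 0 := by
    rw [hu]; exact hβ
  have h2 : ((↑u⁻¹ * ↑u : (Fin 3 → ℂ) →L[ℂ] (Fin 3 → ℂ))) β = 0 := by
    rw [mul_apply_eq_comp, h1, map_zero]
  rwa [Units.inv_mul] at h2

end CRGeometry

/-! ### The frame condition as a spanning condition -/

namespace CRGeometry

open Complex Set Filter Topology Asymptotics

/-- The function `κ` with `∂_z (s̄ + z z̄ q(z, z̄, s̄)) = z̄ κ(z, z̄, s̄)`. -/
noncomputable def slope (q : ℂ × ℂ × (Fin 3 → ℂ) → (Fin 3 → ℂ)) (p : ℂ × ℂ × (Fin 3 → ℂ)) :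
    Fin 3 → ℂ :=
  q p + p.1 • fderiv ℂ q p (1, 0, 0)

theorem analyticAt_slope {q : ℂ × ℂ × (Fin 3 → ℂ) → (Fin 3 → ℂ)} {p : ℂ × ℂ × (Fin 3 → ℂ)}
    (hq : AnalyticAt ℂ q p) : AnalyticAt ℂ (slope q) p := by
  have h1 : AnalyticAt ℂ (fun p => fderiv ℂ q p (1, 0, 0)) p :=
    ((ContinuousLinearMap.apply ℂ (Fin 3 → ℂ)
      ((1, 0, 0) : ℂ × ℂ × (Fin 3 → ℂ))).analyticAt _).comp hq.fderiv
  exact hq.add (analyticAt_fst.smul h1)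

theorem fderiv_slope_zero {q : ℂ × ℂ × (Fin 3 → ℂ) → (Fin 3 → ℂ)} (hq : AnalyticAt ℂ q 0)
    (v : ℂ × ℂ × (Fin 3 → ℂ)) :
    fderiv ℂ (slope q) 0 v = fderiv ℂ q 0 v + v.1 • fderiv ℂ q 0 (1, 0, 0) := by
  have h1 : AnalyticAt ℂ (fun p => fderiv ℂ q p (1, 0, 0)) 0 :=
    ((ContinuousLinearMap.apply ℂ (Fin 3 → ℂ)
      ((1, 0, 0) : ℂ × ℂ × (Fin 3 → ℂ))).analyticAt _).comp hq.fderiv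
  have h2 := hq.differentiableAt.hasFDerivAt.add
    ((hasFDerivAt_fst (𝕜 := ℂ) (p := (0 : ℂ × ℂ × (Fin 3 → ℂ)))).smul
      h1.differentiableAt.hasFDerivAt)
  have h3 : fderiv ℂ (slope q) 0 = _ := h2.fderiv
  rw [h3]
  simp

theorem hasFDerivAt_complex_graph {q : ℂ × ℂ × (Fin 3 → ℂ) → (Fin 3 → ℂ)}
    {p : ℂ × ℂ × (Fin 3 → ℂ)} (hq : AnalyticAt ℂ q p) :
    ∃ D : ℂ × ℂ × (Fin 3 → ℂ) →L[ℂ] (Fin 3 → ℂ),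
      HasFDerivAt (fun p : ℂ × ℂ × (Fin 3 → ℂ) => p.2.2 + (p.1 * p.2.1) • q p) D p ∧
        D (1, 0, 0) = p.2.1 • slope q p := by
  have h1 := hasFDerivAt_fst (𝕜 := ℂ) (p := p)
  have h2 := hasFDerivAt_snd (𝕜 := ℂ) (p := p)
  have h3 : HasFDerivAt (fun p : ℂ × ℂ × (Fin 3 → ℂ) => p.2.1) _ p := h2.fst
  have h4 : HasFDerivAt (fun p : ℂ × ℂ × (Fin 3 → ℂ) => p.2.2) _ p := h2.snd
  refine ⟨_, h4.add ((h1.mul h3).smul hq.differentiableAt.hasFDerivAt), ?_⟩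
  simp [slope, smul_smul, mul_comm]
  abel

/-- The frame condition expressed on the equation `s = s̄ + z z̄ q(z, z̄, s̄)` of the submanifold. -/
theorem span_eq_top_of_frameCondition {M U : Set (Fin 4 → ℂ)} {ρ : (Fin 4 → ℂ) → (Fin 3 → ℝ)}
    (h0 : (0 : Fin 4 → ℂ) ∈ M) (hG : IsCRGeneric M) (hF : FrameCondition M)
    (hU : IsOpen U) (h0U : (0 : Fin 4 → ℂ) ∈ U) (hρ : AnalyticOnNhd ℝ ρ U)
    (hs : ∀ q ∈ U, Function.Surjective (fderiv ℝ ρ q)) (hMU : M ∩ U = {q ∈ U | ρ q = 0})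
    {Φ : OpenPartialHomeomorph (Fin 4 → ℂ) CoordSpace} (hΦs : (0 : Fin 4 → ℂ) ∈ Φ.source)
    (hΦ0 : Φ 0 = 0) (hΦ : AnalyticAt ℂ Φ 0) (hΦsymm : AnalyticAt ℂ Φ.symm 0)
    {R : CoordSpace × CoordSpace → (Fin 3 → ℂ)} (hR : AnalyticAt ℂ R 0)
    (hRρ : ∀ᶠ x in 𝓝 (0 : Fin 4 → ℂ), R (Φ x, star (Φ x)) = fun j => (ρ x j : ℂ))
    (hRd : ∀ P, fderiv ℂ R 0 P = (1 / (2 * I) : ℂ) • (P.1.2 - P.2.2))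
    {q : ℂ × ℂ × (Fin 3 → ℂ) → (Fin 3 → ℂ)} (hq : AnalyticAt ℂ q 0)
    (hRq : ∀ᶠ P in 𝓝 (0 : CoordSpace × CoordSpace), R P = 0 ↔
      P.1.2 = P.2.2 + (P.1.1 * P.2.1) • q (P.1.1, P.2.1, P.2.2)) :
    Submodule.span ℂ {q 0, fderiv ℂ q 0 (1, 0, 0), fderiv ℂ q 0 (0, 1, 0)} = ⊤ := by
  have tΦ := tendsto_zero_of_analyticAt hΦ hΦ0
  have tΦΦ : Tendsto (fun x => (Φ x, star (Φ x))) (𝓝 0) (𝓝 (0 : CoordSpace × CoordSpace)) :=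
    tendsto_zero_pair tΦ (tendsto_zero_star tΦ)
  let J : CoordSpace × CoordSpace →L[ℂ] ℂ × ℂ × (Fin 3 → ℂ) :=
    ((ContinuousLinearMap.fst ℂ ℂ (Fin 3 → ℂ)).comp
      (ContinuousLinearMap.fst ℂ CoordSpace CoordSpace)).prod
      (ContinuousLinearMap.snd ℂ CoordSpace CoordSpace)
  have hJ : ∀ P, J P = (P.1.1, P.2.1, P.2.2) := fun _ => rfl
  have tJ : Tendsto J (𝓝 0) (𝓝 0) := by
    have := J.continuous.tendsto 0
    rwa [map_zero] at this
  have hsl := analyticAt_slope hq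
  -- the functions of the point
  let κ : (Fin 4 → ℂ) → (Fin 3 → ℂ) := fun x => slope q (J (Φ x, star (Φ x)))
  let zb : (Fin 4 → ℂ) → ℂ := fun x => star (Φ x).1
  -- In the chart `L` is `∂_z + z̄ κ ∂_s`. The same formula is used off `M`, so that `L s = z̄ κ`
  -- and `L̄ s = 0` hold on a full neighborhood, as differentiating them in brackets requires.
  let B : (Fin 4 → ℂ) → CoordSpace := fun x => (1, zb x • κ x)
  let L : (Fin 4 → ℂ) → CVec 4 := fun x => (fderiv ℂ Φ.symm (Φ x) (B x), 0)
  have hstar : ∀ {H : Type} [NormedAddCommGroup H] [NormedSpace ℂ H] [StarAddMonoid H]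
      [NormedStarGroup H] [StarModule ℂ H] {f : (Fin 4 → ℂ) → H}, AnalyticAt ℝ f 0 →
      AnalyticAt ℝ (fun x => star (f x)) 0 := fun {H} _ _ _ _ _ f hf =>
    ((starL' ℝ (A := H)).toContinuousLinearMap.analyticAt _).comp hf
  have hΦr : AnalyticAt ℝ Φ 0 := hΦ.restrictScalars
  have hzba : AnalyticAt ℝ zb 0 := by
    have : AnalyticAt ℝ (fun x => (Φ x).1) 0 :=
      AnalyticAt.comp (g := fun P : CoordSpace => P.1) analyticAt_fst hΦr
    exact hstar this
  have hsa : AnalyticAt ℝ (fun x => (Φ x).2) 0 :=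
    AnalyticAt.comp (g := fun P : CoordSpace => P.2) analyticAt_snd hΦr
  have hκa : AnalyticAt ℝ κ 0 := by
    have h1 : AnalyticAt ℝ (fun x => (Φ x, star (Φ x))) 0 := hΦr.prod (hstar hΦr)
    have h2 : AnalyticAt ℝ (fun P => slope q (J P)) 0 :=
      (analyticAt_comp_zero hsl (J.analyticAt 0) (map_zero J)).restrictScalars
    have h3 : AnalyticAt ℝ (fun P => slope q (J P)) (Φ 0, star (Φ 0)) := by
      rw [hΦ0, star_zero]; exact h2
    exact h3.comp (f := fun x => (Φ x, star (Φ x))) h1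
  have hBa : AnalyticAt ℝ B 0 := analyticAt_const.prod (hzba.smul hκa)
  have hLa : AnalyticAt ℝ L 0 := by
    have h1 : AnalyticAt ℝ (fun x => fderiv ℂ Φ.symm (Φ x)) 0 := by
      have : AnalyticAt ℝ (fderiv ℂ Φ.symm) (Φ 0) := by
        rw [hΦ0]; exact hΦsymm.fderiv.restrictScalars
      exact this.comp hΦr
    have hb : AnalyticAt ℝ (fun z : (CoordSpace →L[ℂ] (Fin 4 → ℂ)) × CoordSpace => z.1 z.2)
        (fderiv ℂ Φ.symm (Φ 0), B 0) :=
      ((ContinuousLinearMap.id ℂ (CoordSpace →L[ℂ] (Fin 4 → ℂ))).analyticAt_bilinear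
        _).restrictScalars
    exact (hb.comp (f := fun x => (fderiv ℂ Φ.symm (Φ x), B x)) (h1.prod hBa)).prod
      analyticAt_const
  -- facts that hold near the origin
  have eΦ : ∀ᶠ x in 𝓝 (0 : Fin 4 → ℂ), x ∈ Φ.source ∧ AnalyticAt ℂ Φ x ∧
      AnalyticAt ℂ Φ.symm (Φ x) :=
    (show ∀ᶠ x in 𝓝 0, x ∈ Φ.source from Φ.open_source.mem_nhds hΦs).and (hΦ.eventually_analyticAt.and
      (tΦ.eventually hΦsymm.eventually_analyticAt))
  have eL : ∀ᶠ x in 𝓝 (0 : Fin 4 → ℂ), fderiv ℂ Φ x (L x).1 = B x := by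
    filter_upwards [eΦ] with x hx
    exact fderiv_comp_symm Φ hx.1 hx.2.1 hx.2.2 _
  have eρ : ∀ᶠ x in 𝓝 (0 : Fin 4 → ℂ), ∀ v : CVec 4, derivAlong (fun x j => (ρ x j : ℂ)) x v =
      fderiv ℂ R (Φ x, star (Φ x)) (fderiv ℂ Φ x v.1, star (fderiv ℂ Φ x (star v.2))) := by
    filter_upwards [hRρ.eventually_nhds, eΦ, tΦΦ.eventually hR.eventually_analyticAt]
      with x h1 h2 h3 v
    rw [← derivAlong_congr h1]
    exact (derivAlong_comp_star h2.2.1.differentiableAt.hasFDerivAt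
      h3.differentiableAt.hasFDerivAt v).2
  -- Tangency comes from differentiating `R((z, Q), (ζ, τ)) = 0` in `z` alone, with `ζ, τ` held
  -- fixed; points of `M` satisfy `s = Q`.
  have eR : ∀ᶠ x in 𝓝 (0 : Fin 4 → ℂ), ρ x = 0 →
      fderiv ℂ R (Φ x, star (Φ x)) (B x, 0) = 0 := by
    let Qf : ℂ × ℂ × (Fin 3 → ℂ) → (Fin 3 → ℂ) := fun p => p.2.2 + (p.1 * p.2.1) • q p
    have hQf : AnalyticAt ℂ Qf 0 := by
      have h2 : AnalyticAt ℂ (fun p : ℂ × ℂ × (Fin 3 → ℂ) => p.2.1) 0 :=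
        IsLinearMap.analyticAt_of_finiteDimensional ⟨fun _ _ => rfl, fun _ _ => rfl⟩ _
      have h3 : AnalyticAt ℂ (fun p : ℂ × ℂ × (Fin 3 → ℂ) => p.2.2) 0 :=
        IsLinearMap.analyticAt_of_finiteDimensional ⟨fun _ _ => rfl, fun _ _ => rfl⟩ _
      exact h3.add ((analyticAt_fst.mul h2).smul hq)
    have tQf := tendsto_zero_of_analyticAt hQf (by simp [Qf])
    have t1 : Tendsto (fun p : ℂ × ℂ × (Fin 3 → ℂ) => (((p.1, Qf p), p.2) :
        CoordSpace × CoordSpace)) (𝓝 0) (𝓝 0) :=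
      tendsto_zero_pair (tendsto_zero_pair tendsto_zero_fst tQf) tendsto_zero_snd
    have e1 : ∀ᶠ p in 𝓝 (0 : ℂ × ℂ × (Fin 3 → ℂ)), R ((p.1, Qf p), p.2) = 0 := by
      filter_upwards [t1.eventually hRq] with p hp
      exact hp.2 rfl
    filter_upwards [(tJ.comp tΦΦ).eventually e1.eventually_nhds, tΦΦ.eventually hRq, hRρ,
      (tJ.comp tΦΦ).eventually hq.eventually_analyticAt,
      tΦΦ.eventually hR.eventually_analyticAt] with x h1 h2 h3 h4 h5 hx
    have h6 : R (Φ x, star (Φ x)) = 0 := by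
      rw [h3, hx]; ext; simp
    have h7 : (Φ x).2 = Qf (J (Φ x, star (Φ x))) := h2.1 h6
    obtain ⟨D, hD, hD1⟩ := hasFDerivAt_complex_graph h4
    have h8 : HasFDerivAt R (fderiv ℂ R (Φ x, star (Φ x)))
        (((J (Φ x, star (Φ x))).1, Qf (J (Φ x, star (Φ x)))), (J (Φ x, star (Φ x))).2) := by
      rw [← h7]
      exact h5.differentiableAt.hasFDerivAt
    have h9 := h8.comp (J (Φ x, star (Φ x))) (((hasFDerivAt_fst (𝕜 := ℂ)).prodMk hD).prodMk
      (hasFDerivAt_snd (𝕜 := ℂ)))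
    have h10 := (h9.congr_of_eventuallyEq (f₁ := fun _ => (0 : Fin 3 → ℂ))
      (h1.mono fun p hp => hp.symm)).unique (hasFDerivAt_const _ _)
    have h11 := DFunLike.congr_fun h10 (1, 0, 0)
    refine Eq.trans ?_ h11
    change _ = fderiv ℂ R (Φ x, star (Φ x)) (((1 : ℂ), D (1, 0, 0)), 0)
    rw [hD1]
    rfl
  have einj := tΦΦ.eventually (eventually_injective_fderiv hR hRd)
  -- the generator
  obtain ⟨W, hWsub, hWo, h0W⟩ := eventually_nhds_iff.1 (((hLa.eventually_analyticAt.and eΦ).and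
    (eL.and eρ)).and ((eR.and einj).and (hU.mem_nhds h0U)))
  have hgen : IsLocalGenerator M W L := by
    refine ⟨hWo, fun x hx => (hWsub x hx).1.1.1, fun x hx => ?_⟩
    obtain ⟨⟨⟨-, hx1⟩, hx2, hx3⟩, ⟨hx4, hx5⟩, hxU⟩ := hWsub x hx.2
    have hρx : ρ x = 0 := ((Set.ext_iff.1 hMU x).1 ⟨hx.1, hxU⟩).2
    have hmem := mem_complexTangent_iff hU hMU ⟨hx.1, hxU⟩ (hρ x hxU) (hs x hxU)
    have hBx := hx4 hρx
    refine ⟨fun h => ?_, ?_⟩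
    · have h1 : B x = 0 := by rw [← hx2, h]; simp
      exact one_ne_zero (congrArg Prod.fst h1)
    · ext v
      simp only [SetLike.mem_coe, Submodule.mem_span_singleton]
      constructor
      · rintro ⟨c, rfl⟩
        refine ⟨(hmem _).2 ?_, by simp [L]⟩
        rw [← derivAlongL_apply, map_smul, derivAlongL_apply, hx3]
        have : star (fderiv ℂ Φ x (star (L x).2)) = 0 := by simp [L]
        rw [hx2, this, hBx, smul_zero]
      · rintro ⟨hv, hv2⟩
        have h1 := (hmem v).1 hv
        rw [hx3, hv2, star_zero, map_zero, star_zero] at h1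
        refine ⟨(fderiv ℂ Φ x v.1).1, ?_⟩
        -- After subtracting the multiple of `L` with the same `z`-component, a `(1,0)` tangent
        -- vector has only an `s`-component and is killed by the derivative of `R`, hence is zero.
        have h2 : (fderiv ℂ Φ x v.1 : CoordSpace) = (fderiv ℂ Φ x v.1).1 • B x := by
          refine Prod.ext (by simp [B]) ?_
          rw [← sub_eq_zero]
          refine hx5 _ ?_
          have h3 : (((0, (fderiv ℂ Φ x v.1).2 - ((fderiv ℂ Φ x v.1).1 • B x).2), 0) :
              CoordSpace × CoordSpace) = (fderiv ℂ Φ x v.1, 0) -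
                (fderiv ℂ Φ x v.1).1 • (B x, 0) := by
            ext <;> simp [B]
          rw [h3, map_sub, map_smul, h1, hBx, smul_zero, sub_zero]
        refine Prod.ext ?_ (by simp [L, hv2])
        have h4 := congrArg (fderiv ℂ Φ.symm (Φ x)) h2
        rw [fderiv_symm_comp Φ hx1.1 hx1.2.1 hx1.2.2, map_smul] at h4
        exact h4.symm
  obtain ⟨-, hspan⟩ := hF W L hgen 0 ⟨h0, h0W⟩
  -- the five fields on `s`
  have hΦ' : ∀ᶠ x in 𝓝 (0 : Fin 4 → ℂ), HasFDerivAt Φ (fderiv ℂ Φ x) x := by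
    filter_upwards [eΦ] with x hx using hx.2.1.differentiableAt.hasFDerivAt
  have dS : ∀ᶠ x in 𝓝 (0 : Fin 4 → ℂ), ∀ v : CVec 4,
      derivAlong (fun x => (Φ x).2) x v = (fderiv ℂ Φ x v.1).2 := by
    filter_upwards [hΦ'] with x hx v
    exact derivAlong_of_hasFDerivAt hx.snd v
  have dZ : ∀ᶠ x in 𝓝 (0 : Fin 4 → ℂ), ∀ v : CVec 4,
      derivAlong zb x v = star (fderiv ℂ Φ x (star v.2)).1 := by
    filter_upwards [hΦ'] with x hx v
    have h1 : HasFDerivAt (fun P : CoordSpace × CoordSpace => P.2.1)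
        ((ContinuousLinearMap.fst ℂ ℂ (Fin 3 → ℂ)).comp
          (ContinuousLinearMap.snd ℂ CoordSpace CoordSpace)) (Φ x, star (Φ x)) :=
      ((ContinuousLinearMap.fst ℂ ℂ (Fin 3 → ℂ)).comp
          (ContinuousLinearMap.snd ℂ CoordSpace CoordSpace)).hasFDerivAt
    exact (derivAlong_comp_star hx h1 v).2
  have hzb0 : zb 0 = 0 := by simp [zb, hΦ0]
  have hfive := derivAlong_fiveFields hLa hsa hκa hzba hzb0
    (by
      filter_upwards [dS, eL] with x h1 h2
      rw [h1, h2])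
    (by
      filter_upwards [dS] with x h1
      rw [h1]
      simp [conjField, conjVec, L])
    (by
      filter_upwards [dZ] with x h1
      rw [h1]
      simp [L])
    (by
      filter_upwards [dZ, eL] with x h1 h2
      rw [h1]
      simp only [conjField, conjVec, star_star]
      rw [h2]
      simp [B])
  have hκd : ∀ v : CVec 4, derivAlong κ 0 v =
      fderiv ℂ (slope q) 0 (J (fderiv ℂ Φ 0 v.1, star (fderiv ℂ Φ 0 (star v.2)))) := by
    intro v
    have h1 : HasFDerivAt (fun P => slope q (J P)) (fderiv ℂ (fun P => slope q (J P)) 0)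
        (Φ 0, star (Φ 0)) := by
      have := (analyticAt_comp_zero hsl (J.analyticAt 0) (map_zero J)).differentiableAt.hasFDerivAt
      rw [hΦ0, star_zero]
      exact this
    rw [(derivAlong_comp_star hΦ'.self_of_nhds h1 v).2, fderiv_comp_zero hsl (J.analyticAt 0)
      (map_zero J), J.fderiv]
  have hB0 : B 0 = (1, 0) := by simp [B, hzb0]
  have hL0 : fderiv ℂ Φ 0 (L 0).1 = (1, 0) := by rw [eL.self_of_nhds, hB0]
  set S := Submodule.span ℂ {q 0, fderiv ℂ q 0 (1, 0, 0), fderiv ℂ q 0 (0, 1, 0)} with hS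
  have m1 : q 0 ∈ S := Submodule.subset_span (by simp)
  have m2 : fderiv ℂ q 0 (1, 0, 0) ∈ S := Submodule.subset_span (by simp)
  have m3 : fderiv ℂ q 0 (0, 1, 0) ∈ S := Submodule.subset_span (by simp)
  -- At the origin `κ = q`, `Lκ = 2 q_z` and `L̄κ = q_ζ`.
  have hin : ∀ i, derivAlong (fun x => (Φ x).2) 0 (fiveFields L i 0) ∈ S := by
    intro i
    rw [hfive i]
    fin_cases i
    · exact S.zero_mem
    · exact S.zero_mem
    · refine S.neg_mem ?_
      have hJ0 : J (0, 0) = 0 := map_zero J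
      have : κ 0 = q 0 := by simp [κ, slope, hΦ0, hJ0]
      rw [this]; exact m1
    · refine S.neg_mem ?_
      rw [hκd, hL0, hJ, fderiv_slope_zero hq]
      have : star (fderiv ℂ Φ 0 (star (L 0).2)) = 0 := by simp [L]
      rw [this]
      exact S.add_mem m2 (S.smul_mem _ m2)
    · refine S.neg_mem (S.smul_mem _ ?_)
      rw [hκd, hJ, fderiv_slope_zero hq]
      have e1 : star (fderiv ℂ Φ 0 (star (conjField L 0).2)) = (1, 0) := by
        simp only [conjField, conjVec, star_star]
        rw [hL0]
        ext <;> simp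
      have e2 : fderiv ℂ Φ 0 (conjField L 0).1 = 0 := by simp [conjField, conjVec, L]
      rw [e1, e2]
      exact S.add_mem m3 (S.smul_mem _ m2)
  have hle : ∀ w ∈ complexTangent M 0, derivAlong (fun x => (Φ x).2) 0 w ∈ S := by
    intro w hw
    rw [← hspan] at hw
    have h1 : Submodule.span ℂ (range fun i => fiveFields L i 0) ≤
        S.comap (derivAlongL (fun x => (Φ x).2) 0) := by
      rw [Submodule.span_le]
      rintro _ ⟨i, rfl⟩
      exact hin i
    exact h1 hw
  rw [eq_top_iff]
  intro y _
  -- Genericity makes `ds` map `ℂ ⊗ T_0 M` onto `ℂ³`, while the frame keeps the image inside `S`.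
  obtain ⟨a, ha, b, hb, hab⟩ := hG 0 h0 (fderiv ℂ Φ.symm (Φ 0) (0, y))
  have hT0 : (0 : Fin 4 → ℂ) ∈ tangentVectors M 0 :=
    ⟨fun _ => 0, rfl, Eventually.of_forall fun _ => h0, hasDerivAt_const _ _⟩
  have hct : ∀ a ∈ tangentVectors M 0, ((a, star a) : CVec 4) ∈ complexTangent M 0 := by
    intro a ha
    have e1 : rePart ((a, star a) : CVec 4) = a := by
      ext k; simp [rePart]; ring
    have e2 : imPart ((a, star a) : CVec 4) = 0 := by
      ext k; simp [imPart]
    exact ⟨by rw [e1]; exact ha, by rw [e2]; exact hT0⟩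
  have h1 := S.add_mem (hle _ (hct a ha)) (S.smul_mem I (hle _ (hct b hb)))
  rw [dS.self_of_nhds, dS.self_of_nhds] at h1
  have h2 : fderiv ℂ Φ 0 (a + I • b) = (0, y) := by
    rw [← hab]
    obtain ⟨e1, e2, e3⟩ := eΦ.self_of_nhds
    exact fderiv_comp_symm Φ e1 e2 e3 _
  have h3 := congrArg Prod.snd h2
  rw [map_add, map_smul] at h3
  rw [← show _ = y from h3]
  exact h1

end CRGeometry

/-! ### Remainders and linear normalization of the jet -/

namespace CRGeometry

open Complex Set Filter Topology Asymptotics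

theorem isBigO_norm_sq_of_fderiv_eq_zero {𝕜 E F : Type*} [NontriviallyNormedField 𝕜]
    [NormedAddCommGroup E] [NormedSpace 𝕜 E] [NormedAddCommGroup F] [NormedSpace 𝕜 F]
    {f : E → F} (hf : AnalyticAt 𝕜 f 0) (h0 : f 0 = 0) (h1 : fderiv 𝕜 f 0 = 0) :
    f =O[𝓝 0] fun x => ‖x‖ ^ 2 := by
  obtain ⟨p, hp⟩ := hf
  have h2 := hp.isBigO_sub_partialSum_pow 2
  refine h2.congr_left fun y => ?_
  have e0 : p 0 (fun _ : Fin 0 => y) = 0 := by rw [hp.coeff_zero, h0]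
  have e1 : p 1 (fun _ : Fin 1 => y) = 0 := by
    have := hp.fderiv_eq
    rw [h1] at this
    have h3 := DFunLike.congr_fun this y
    simp only [zero_apply, continuousMultilinearCurryFin1_apply] at h3
    rw [h3]
    congr 1
  simp [FormalMultilinearSeries.partialSum, Finset.sum_range_succ, e0, e1]

/-- Hadamard's lemma in the real variables `u`, with analytic quotients. -/
theorem exists_hadamard_quotients {f : ℂ × (Fin 3 → ℝ) → ℝ} (hf : AnalyticAt ℝ f 0) :
    ∃ S : Fin 3 → ℂ × (Fin 3 → ℝ) → ℝ, (∀ l, AnalyticAt ℝ (S l) 0) ∧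
      ∀ᶠ x in 𝓝 0, f x - f (x.1, 0) = ∑ l, x.2 l * S l x := by
  let ℓ : Fin 3 → (ℂ × (Fin 3 → ℝ)) →L[ℝ] ℝ := fun l =>
    (ContinuousLinearMap.proj (R := ℝ) (φ := fun _ : Fin 3 => ℝ) l).comp
      (ContinuousLinearMap.snd ℝ ℂ (Fin 3 → ℝ))
  let e : Fin 3 → ℂ × (Fin 3 → ℝ) := fun l => (0, Pi.single l 1)
  choose S hS hSe using fun l => exists_analyticAt_smul_eq_sub hf (ℓ l) (e l)
  let π : Fin 3 → (ℂ × (Fin 3 → ℝ)) →L[ℝ] ℂ × (Fin 3 → ℝ) := fun l =>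
    ContinuousLinearMap.id ℝ _ - (ℓ l).smulRight (e l)
  have hπ : ∀ l x, π l x = x - ℓ l x • e l := fun l x => rfl
  have hcomp : ∀ (T : (ℂ × (Fin 3 → ℝ)) →L[ℝ] ℂ × (Fin 3 → ℝ)) (l : Fin 3),
      AnalyticAt ℝ (fun x => S l (T x)) 0 := fun T l => by
    have : AnalyticAt ℝ (S l) (T 0) := by rw [map_zero]; exact hS l
    exact this.comp (T.analyticAt 0)
  have ht : ∀ (T : (ℂ × (Fin 3 → ℝ)) →L[ℝ] ℂ × (Fin 3 → ℝ)), Tendsto T (𝓝 0) (𝓝 0) := fun T => by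
    have := T.continuous.tendsto 0
    rwa [map_zero] at this
  -- The variables `u` are set to zero one after another, so each quotient is evaluated where the
  -- earlier variables already vanish.
  refine ⟨![S 0, fun x => S 1 (π 0 x), fun x => S 2 ((π 1).comp (π 0) x)], fun l => ?_, ?_⟩
  · fin_cases l
    · exact hS 0
    · exact hcomp (π 0) 1
    · exact hcomp ((π 1).comp (π 0)) 2
  · filter_upwards [hSe 0, (ht (π 0)).eventually (hSe 1),
      (ht ((π 1).comp (π 0))).eventually (hSe 2)] with x h1 h2 h3
    rw [← hπ] at h1 h2 h3
    have e1 : ℓ 1 (π 0 x) = x.2 1 := by simp [hπ, ℓ, e]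
    have e2 : ℓ 2 ((π 1).comp (π 0) x) = x.2 2 := by simp [hπ, ℓ, e]
    have e3 : π 2 ((π 1).comp (π 0) x) = (x.1, 0) := by
      refine Prod.ext ?_ ?_
      · simp [hπ, ℓ, e]
      · ext i
        fin_cases i <;> simp [hπ, ℓ, e]
    have e0 : ℓ 0 x = x.2 0 := rfl
    rw [e1] at h2
    rw [e2, e3] at h3
    rw [e0] at h1
    simp only [smul_eq_mul, ContinuousLinearMap.comp_apply] at h1 h2 h3
    rw [Fin.sum_univ_three]
    simp only [Matrix.cons_val_zero, Matrix.cons_val_one, Matrix.cons_val,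
      ContinuousLinearMap.comp_apply]
    linarith

/-- A graph `Im s = z z̄ χ(z, Re s)` is normalized as soon as `χ` has the right first order
jet. -/
theorem exists_isNormalizedGraph {χ : ℂ × (Fin 3 → ℝ) → (Fin 3 → ℝ)} (hχ : AnalyticAt ℝ χ 0)
    (h0 : χ 0 = ![1, 0, 0])
    (h1 : ∀ t : ℂ, fderiv ℝ χ 0 (t, 0) = ![0, 2 * t.re, -(2 * t.im)]) :
    ∃ r : ℝ, 0 < r ∧ IsNormalizedGraph r (fun j x => normSq x.1 * χ x j) := by
  have hχj : ∀ j, AnalyticAt ℝ (fun x => χ x j) 0 := fun j =>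
    ((ContinuousLinearMap.proj (R := ℝ) (φ := fun _ : Fin 3 => ℝ) j).analyticAt _).comp hχ
  choose S hS hSe using fun j => exists_hadamard_quotients (hχj j)
  let ι : ℂ →L[ℝ] ℂ × (Fin 3 → ℝ) := ContinuousLinearMap.inl ℝ ℂ (Fin 3 → ℝ)
  -- After division by `z z̄` the cubic leading terms become `z + z̄ = 2 Re z` and `i(z - z̄) = -2
  -- Im z`.
  let lead : Fin 3 → ℂ →L[ℝ] ℝ := ![0, (2 : ℝ) • reCLM, -((2 : ℝ) • imCLM)]
  let R : Fin 3 → ℂ → ℝ := fun j z => χ (z, 0) j - ((![1, 0, 0] : Fin 3 → ℝ) j + lead j z)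
  have hχι : ∀ j, AnalyticAt ℝ (fun z : ℂ => χ (z, 0) j) 0 := fun j => by
    have : AnalyticAt ℝ (fun x => χ x j) (ι 0) := by rw [map_zero]; exact hχj j
    exact this.comp (ι.analyticAt 0)
  have hR : ∀ j, AnalyticAt ℝ (R j) 0 := fun j =>
    (hχι j).sub (analyticAt_const.add ((lead j).analyticAt 0))
  have hRO : ∀ j, (R j) =O[𝓝 0] fun z => ‖z‖ ^ 2 := by
    intro j
    refine isBigO_norm_sq_of_fderiv_eq_zero (hR j) ?_ ?_
    · have : χ ((0 : ℂ), (0 : Fin 3 → ℝ)) = ![1, 0, 0] := h0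
      simp only [R, this, map_zero, add_zero, sub_self]
    · have hc : HasFDerivAt (fun z : ℂ => χ (z, 0) j)
          ((ContinuousLinearMap.proj (R := ℝ) (φ := fun _ : Fin 3 => ℝ) j).comp
            ((fderiv ℝ χ 0).comp ι)) 0 := by
        have hχd : HasFDerivAt χ (fderiv ℝ χ 0) (ι 0) := by
          rw [map_zero]; exact hχ.differentiableAt.hasFDerivAt
        exact (ContinuousLinearMap.proj (R := ℝ) (φ := fun _ : Fin 3 => ℝ) j).hasFDerivAt.comp
          (0 : ℂ) (hχd.comp (0 : ℂ) ι.hasFDerivAt)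
      have h2 := hc.sub ((hasFDerivAt_const ((![1, 0, 0] : Fin 3 → ℝ) j) (0 : ℂ)).add
        (lead j).hasFDerivAt)
      have h3 : fderiv ℝ (R j) 0 = _ := h2.fderiv
      rw [h3]
      refine ContinuousLinearMap.ext fun t => ?_
      have h4 : fderiv ℝ χ 0 (ι t) = ![0, 2 * t.re, -(2 * t.im)] := h1 t
      simp only [sub_apply, zero_apply, ContinuousLinearMap.comp_apply, h4,
        ContinuousLinearMap.proj_apply, zero_add]
      fin_cases j <;> simp [lead]
  have hφ : ∀ j, AnalyticAt ℝ (fun x : ℂ × (Fin 3 → ℝ) => normSq x.1 * χ x j) 0 := by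
    intro j
    have h2 : AnalyticAt ℝ (fun x : ℂ × (Fin 3 → ℝ) => normSq x.1) 0 := by
      have hre : AnalyticAt ℝ (fun x : ℂ × (Fin 3 → ℝ) => x.1.re) 0 :=
        (reCLM.comp (ContinuousLinearMap.fst ℝ ℂ (Fin 3 → ℝ))).analyticAt 0
      have him : AnalyticAt ℝ (fun x : ℂ × (Fin 3 → ℝ) => x.1.im) 0 :=
        (imCLM.comp (ContinuousLinearMap.fst ℝ ℂ (Fin 3 → ℝ))).analyticAt 0
      simp only [normSq_apply]
      exact (hre.mul hre).add (him.mul him)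
    exact h2.mul (hχj j)
  obtain ⟨r1, hr1, hb1⟩ := Metric.eventually_nhds_iff_ball.1
    ((eventually_all.2 fun j => (hφ j).eventually_analyticAt).and
    ((eventually_all.2 fun j => eventually_all.2 fun l => (hS j l).eventually_analyticAt).and
      (eventually_all.2 hSe)))
  obtain ⟨r2, hr2, hb2⟩ := Metric.eventually_nhds_iff_ball.1
    (eventually_all.2 fun j => (hR j).eventually_analyticAt)
  refine ⟨min r1 r2, lt_min hr1 hr2, fun j x hx => ?_, R, S, fun j z hz => ?_, hRO,
    fun j l x hx => ?_, fun z u hzu j => ?_⟩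
  · exact (hb1 x (Metric.ball_subset_ball (min_le_left _ _) hx)).1 j
  · exact hb2 z (Metric.ball_subset_ball (min_le_right _ _) hz) j
  · exact (hb1 x (Metric.ball_subset_ball (min_le_left _ _) hx)).2.1 j l
  · have h2 := (hb1 _ (Metric.ball_subset_ball (min_le_left _ _) hzu)).2.2 j
    simp only at h2
    have h3 : χ (z, u) j = (![1, 0, 0] : Fin 3 → ℝ) j + lead j z + R j z +
        ∑ l, u l * S j l (z, u) := by
      rw [← h2]; simp only [R]; ring
    have h4 : leadingTerm z j = z * star z * (((![1, 0, 0] : Fin 3 → ℝ) j + lead j z : ℝ) : ℂ) := by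
      have e1 : ((2 * z.re : ℝ) : ℂ) = z + star z := by
        rw [star_def, add_conj]
      have e2 : ((-(2 * z.im) : ℝ) : ℂ) = I * (z - star z) := by
        rw [star_def, sub_conj]
        push_cast
        linear_combination (-2 * (z.im : ℂ)) * I_mul_I
      fin_cases j
      · simp [leadingTerm, lead]
      · have : (((![1, 0, 0] : Fin 3 → ℝ) 1 + lead 1 z : ℝ) : ℂ) = z + star z := by
          rw [← e1]; simp [lead]
        change z ^ 2 * star z + z * star z ^ 2 = _ * (((![1, 0, 0] : Fin 3 → ℝ) 1 + lead 1 z : ℝ) : ℂ)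
        rw [this]; ring
      · have : (((![1, 0, 0] : Fin 3 → ℝ) 2 + lead 2 z : ℝ) : ℂ) = I * (z - star z) := by
          rw [← e2]; simp [lead]
        change I * (z ^ 2 * star z - z * star z ^ 2) =
          _ * (((![1, 0, 0] : Fin 3 → ℝ) 2 + lead 2 z : ℝ) : ℂ)
        rw [this]; ring
    change ((normSq z * χ (z, u) j : ℝ) : ℂ) = _
    rw [h4, h3, ofReal_mul, ← mul_conj]
    simp only [ofReal_add, ofReal_sum, Finset.mul_sum, star_def, mul_add]

/-- Linear normalization of the first order jet. -/
theorem exists_linearEquiv_jet {a p p' : Fin 3 → ℝ}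
    (h : Submodule.span ℝ {a, p, p'} = ⊤) :
    ∃ B : (Fin 3 → ℝ) ≃ₗ[ℝ] (Fin 3 → ℝ), B a = ![1, 0, 0] ∧ B p = ![0, 2, 0] ∧
      B p' = ![0, 0, -2] := by
  -- These rescaled vectors are the ones to be sent to the standard basis.
  let v : Fin 3 → (Fin 3 → ℝ) := ![a, (1 / 2 : ℝ) • p, -(1 / 2 : ℝ) • p']
  have hv : ⊤ ≤ Submodule.span ℝ (range v) := by
    rw [← h, Submodule.span_le]
    have h0 : v 0 ∈ Submodule.span ℝ (range v) := Submodule.subset_span ⟨0, rfl⟩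
    have h1 : v 1 ∈ Submodule.span ℝ (range v) := Submodule.subset_span ⟨1, rfl⟩
    have h2 : v 2 ∈ Submodule.span ℝ (range v) := Submodule.subset_span ⟨2, rfl⟩
    rintro x (rfl | rfl | rfl)
    · exact h0
    · have := Submodule.smul_mem _ (2 : ℝ) h1
      simpa [v, smul_smul] using! this
    · have := Submodule.smul_mem _ (-2 : ℝ) h2
      simpa [v, smul_smul] using! this
  let b := Module.Basis.mk (linearIndependent_of_top_le_span_of_card_eq_finrank hv (by simp)) hv
  have hb : ∀ i, b.equivFun (v i) = Pi.single i 1 := by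
    intro i
    have : v i = b i := (Module.Basis.mk_apply _ _ i).symm
    rw [this]
    ext k
    rw [b.equivFun_self, Pi.single_apply]
    simp [eq_comm]
  refine ⟨b.equivFun, ?_, ?_, ?_⟩
  · have := hb 0
    simp only [v, Matrix.cons_val_zero] at this
    rw [this]
    ext k; fin_cases k <;> simp
  · have h1 : p = (2 : ℝ) • v 1 := by simp [v, smul_smul]
    rw [h1, map_smul, hb]
    ext k; fin_cases k <;> simp
  · have h1 : p' = (-2 : ℝ) • v 2 := by simp [v, smul_smul]
    rw [h1, map_smul, hb]
    ext k; fin_cases k <;> simp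

/-- The complexification of a real linear automorphism. -/
theorem exists_complexified_linearEquiv (B : (Fin 3 → ℝ) ≃ₗ[ℝ] (Fin 3 → ℝ)) :
    ∃ C : (Fin 3 → ℂ) ≃L[ℂ] (Fin 3 → ℂ), ∀ s, (fun j => (C s j).re) = B (fun j => (s j).re) ∧
      (fun j => (C s j).im) = B (fun j => (s j).im) := by
  let T : ((Fin 3 → ℝ) ≃ₗ[ℝ] (Fin 3 → ℝ)) → (Fin 3 → ℂ) → (Fin 3 → ℂ) := fun B s j =>
    (B (fun j => (s j).re) j : ℂ) + B (fun j => (s j).im) j * I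
  have hre : ∀ B s, (fun j => (T B s j).re) = B (fun j => (s j).re) := fun B s => by
    ext j; simp [T]
  have him : ∀ B s, (fun j => (T B s j).im) = B (fun j => (s j).im) := fun B s => by
    ext j; simp [T]
  have hinv : ∀ B s, T B.symm (T B s) = s := fun B s => by
    ext j
    have h1 := congrFun (hre B.symm (T B s)) j
    have h2 := congrFun (him B.symm (T B s)) j
    rw [hre, LinearEquiv.symm_apply_apply] at h1
    rw [him, LinearEquiv.symm_apply_apply] at h2
    exact Complex.ext h1 h2
  let E : (Fin 3 → ℂ) ≃ₗ[ℂ] (Fin 3 → ℂ) :=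
    { toFun := T B
      map_add' := fun s t => by
        have e1 : (fun j => ((s + t) j).re) = (fun j => (s j).re) + fun j => (t j).re := rfl
        have e2 : (fun j => ((s + t) j).im) = (fun j => (s j).im) + fun j => (t j).im := rfl
        ext j
        change (B (fun j => ((s + t) j).re) j : ℂ) + B (fun j => ((s + t) j).im) j * I = _
        rw [e1, e2]
        simp only [T, map_add, Pi.add_apply]
        push_cast
        ring
      map_smul' := fun c s => by
        have e1 : (fun j => ((c • s) j).re) =
          c.re • (fun j => (s j).re) - c.im • fun j => (s j).im := by ext j; simp
        have e2 : (fun j => ((c • s) j).im) =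
          c.re • (fun j => (s j).im) + c.im • fun j => (s j).re := by ext j; simp
        ext j
        change (B (fun j => ((c • s) j).re) j : ℂ) + B (fun j => ((c • s) j).im) j * I = _
        rw [e1, e2]
        simp only [T, map_add, map_sub, map_smul, Pi.add_apply, Pi.sub_apply, Pi.smul_apply,
          smul_eq_mul, RingHom.id_apply]
        conv_rhs => rw [← re_add_im c]
        push_cast
        linear_combination (-(c.im : ℂ) * B (fun j => (s j).im) j) * I_mul_I
      invFun := T B.symm
      left_inv := hinv B
      right_inv := hinv B.symm }
  exact ⟨E.toContinuousLinearEquiv, fun s => ⟨hre B s, him B s⟩⟩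

/-- The analytic inverse function theorem at the origin. -/
theorem exists_openPartialHomeomorph {X Y : Type*} [NormedAddCommGroup X] [NormedSpace ℂ X]
    [CompleteSpace X] [NormedAddCommGroup Y] [NormedSpace ℂ Y] [CompleteSpace Y] {f : X → Y}
    (hf : AnalyticAt ℂ f 0) (h0 : f 0 = 0) (e : X ≃L[ℂ] Y) (he : ∀ v, fderiv ℂ f 0 v = e v) :
    ∃ Φ : OpenPartialHomeomorph X Y, (0 : X) ∈ Φ.source ∧ (Φ : X → Y) = f ∧
      AnalyticAt ℂ Φ.symm 0 := by
  have hc : ContDiffAt ℂ ⊤ f 0 := hf.contDiffAt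
  have hd : HasFDerivAt f (e : X →L[ℂ] Y) 0 := by
    have : (e : X →L[ℂ] Y) = fderiv ℂ f 0 := ContinuousLinearMap.ext fun v => (he v).symm
    rw [this]; exact hf.differentiableAt.hasFDerivAt
  have hn : (⊤ : WithTop ℕ∞) ≠ 0 := by simp
  refine ⟨hc.toOpenPartialHomeomorph f hd hn, hc.mem_toOpenPartialHomeomorph_source hd hn, rfl, ?_⟩
  have h1 : AnalyticAt ℂ (hc.localInverse hd hn) (f 0) := (hc.to_localInverse hd hn).analyticAt
  rw [h0] at h1
  exact h1

end CRGeometry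

/-! ### Assembling the normal form -/

namespace CRGeometry

open Complex Set Filter Topology Asymptotics

/-- If real vectors span `ℂ³` over `ℂ`, they span `ℝ³` over `ℝ`. -/
theorem span_real_eq_top {a p p' : Fin 3 → ℝ}
    (h : Submodule.span ℂ {fun j => (a j : ℂ), fun j => (p j : ℂ), fun j => (p' j : ℂ)} = ⊤) :
    Submodule.span ℝ {a, p, p'} = ⊤ := by
  rw [eq_top_iff]
  intro y _
  have hy : (fun j => (y j : ℂ)) ∈ Submodule.span ℂ
      {fun j => (a j : ℂ), fun j => (p j : ℂ), fun j => (p' j : ℂ)} := by rw [h]; trivial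
  obtain ⟨α, β, γ, hs⟩ := Submodule.mem_span_triple.1 hy
  refine Submodule.mem_span_triple.2 ⟨α.re, β.re, γ.re, ?_⟩
  ext j
  have := congrArg re (congrFun hs j)
  simpa using this

/-- A complexified real linear map acts by the same real matrix on `Re s` and `Im s`, so it carries
the graph of `z z̄ g(z, u)` to that of `z z̄ B g(z, B⁻¹ u)`. Choosing `B` from the 1-jet of `g`
completes the normalization. -/
theorem exists_normal_form_of_graph {M U : Set (Fin 4 → ℂ)} {ρ : (Fin 4 → ℂ) → (Fin 3 → ℝ)}
    (hU : IsOpen U) (h0U : (0 : Fin 4 → ℂ) ∈ U) (hMU : M ∩ U = {q ∈ U | ρ q = 0})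
    {Φ : OpenPartialHomeomorph (Fin 4 → ℂ) CoordSpace} (hΦs : (0 : Fin 4 → ℂ) ∈ Φ.source)
    (hΦ0 : Φ 0 = 0) (hΦ : AnalyticAt ℂ Φ 0) (hΦsymm : AnalyticAt ℂ Φ.symm 0)
    {ψ : ℂ × ℂ × (Fin 3 → ℂ) → (Fin 3 → ℂ)} (hψ : AnalyticAt ℂ ψ 0)
    (hspan : Submodule.span ℂ {ψ 0, fderiv ℂ ψ 0 (1, 0, 0), fderiv ℂ ψ 0 (0, 1, 0)} = ⊤)
    (hreal : ∀ᶠ x in 𝓝 (0 : ℂ × (Fin 3 → ℝ)), star (ψ (x.1, star x.1, fun j => (x.2 j : ℂ))) =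
        ψ (x.1, star x.1, fun j => (x.2 j : ℂ)))
    (hgraph : ∀ᶠ x in 𝓝 (0 : Fin 4 → ℂ), ρ x = 0 ↔ (fun j => (((Φ x).2 j).im : ℂ)) =
        ((Φ x).1 * star (Φ x).1) • ψ ((Φ x).1, star (Φ x).1, fun j => (((Φ x).2 j).re : ℂ))) :
    ∃ Φ : OpenPartialHomeomorph (Fin 4 → ℂ) (Fin 4 → ℂ),
      (0 : Fin 4 → ℂ) ∈ Φ.source ∧ Φ 0 = 0 ∧
      AnalyticOnNhd ℂ Φ Φ.source ∧ AnalyticOnNhd ℂ Φ.symm Φ.target ∧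
      ∃ r : ℝ, 0 < r ∧ ∃ φ : Fin 3 → ℂ × (Fin 3 → ℝ) → ℝ,
        IsNormalizedGraph r φ ∧
        ∀ x ∈ Φ.source,
          (Φ x 0, fun l : Fin 3 => (Φ x l.succ).re) ∈ Metric.ball (0 : ℂ × (Fin 3 → ℝ)) r ∧
          (x ∈ M ↔ ∀ j : Fin 3,
            (Φ x j.succ).im = φ j (Φ x 0, fun l : Fin 3 => (Φ x l.succ).re)) := by
  have tΦ := tendsto_zero_of_analyticAt hΦ hΦ0
  -- the real form of `ψ`
  let N : (ℂ × (Fin 3 → ℝ)) →L[ℝ] ℂ × ℂ × (Fin 3 → ℂ) :=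
    (ContinuousLinearMap.fst ℝ ℂ (Fin 3 → ℝ)).prod
      (((starL' ℝ (A := ℂ)).toContinuousLinearMap.comp
        (ContinuousLinearMap.fst ℝ ℂ (Fin 3 → ℝ))).prod
      (ContinuousLinearMap.pi fun j => ofRealCLM.comp
        ((ContinuousLinearMap.proj (R := ℝ) (φ := fun _ : Fin 3 => ℝ) j).comp
          (ContinuousLinearMap.snd ℝ ℂ (Fin 3 → ℝ)))))
  have hN : ∀ x, N x = (x.1, star x.1, fun j => (x.2 j : ℂ)) := fun _ => rfl
  let reL : (Fin 3 → ℂ) →L[ℝ] (Fin 3 → ℝ) := ContinuousLinearMap.pi fun j =>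
    reCLM.comp (ContinuousLinearMap.proj (R := ℝ) (φ := fun _ : Fin 3 => ℂ) j)
  let g : ℂ × (Fin 3 → ℝ) → (Fin 3 → ℝ) := fun x => reL (ψ (N x))
  have hψN : AnalyticAt ℝ (fun x => ψ (N x)) 0 := by
    have : AnalyticAt ℝ ψ (N 0) := by rw [map_zero]; exact hψ.restrictScalars
    exact this.comp (N.analyticAt 0)
  have hg : AnalyticAt ℝ g 0 := (reL.analyticAt _).comp hψN
  have hgψ : ∀ᶠ x in 𝓝 (0 : ℂ × (Fin 3 → ℝ)), (fun j => (g x j : ℂ)) = ψ (N x) := by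
    filter_upwards [hreal] with x hx
    ext j
    exact conj_eq_iff_re.1 (congrFun hx j)
  have hψNd : HasFDerivAt (fun x => ψ (N x)) (((fderiv ℂ ψ 0).restrictScalars ℝ).comp N) 0 := by
    have h1 : HasFDerivAt ψ ((fderiv ℂ ψ 0).restrictScalars ℝ) (N 0) := by
      rw [map_zero]; exact hψ.differentiableAt.hasFDerivAt.restrictScalars ℝ
    exact h1.comp (0 : ℂ × (Fin 3 → ℝ)) N.hasFDerivAt
  have hgd : ∀ v, (fun j => (fderiv ℝ g 0 v j : ℂ)) = fderiv ℂ ψ 0 (N v) := by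
    intro v
    let cL : (Fin 3 → ℝ) →L[ℝ] (Fin 3 → ℂ) := ContinuousLinearMap.pi fun j =>
      ofRealCLM.comp (ContinuousLinearMap.proj (R := ℝ) (φ := fun _ : Fin 3 => ℝ) j)
    have h1 : HasFDerivAt (fun x => cL (g x)) (cL.comp (fderiv ℝ g 0)) 0 :=
      cL.hasFDerivAt.comp (0 : ℂ × (Fin 3 → ℝ)) hg.differentiableAt.hasFDerivAt
    have h2 := (hψNd.congr_of_eventuallyEq hgψ).unique h1
    exact (DFunLike.congr_fun h2 v).symm
  have hg0 : (fun j => (g 0 j : ℂ)) = ψ 0 := by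
    have := hgψ.self_of_nhds
    rwa [map_zero] at this
  -- The real directions `1` and `i` correspond to `∂_z + ∂_ζ` and `i(∂_z - ∂_ζ)`, which span the
  -- same complex plane as `∂_z` and `∂_ζ`.
  obtain ⟨B, hB0, hB1, hB2⟩ := exists_linearEquiv_jet (a := g 0) (p := fderiv ℝ g 0 (1, 0))
    (p' := fderiv ℝ g 0 (I, 0)) (by
      refine span_real_eq_top ?_
      rw [hg0, hgd, hgd, eq_top_iff, ← hspan, Submodule.span_le]
      have e1 : fderiv ℂ ψ 0 (N (1, 0)) = fderiv ℂ ψ 0 (1, 0, 0) + fderiv ℂ ψ 0 (0, 1, 0) := by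
        rw [← map_add]
        congr 1
        ext <;> simp [hN]
      have e2 : fderiv ℂ ψ 0 (N (I, 0)) =
          I • (fderiv ℂ ψ 0 (1, 0, 0) - fderiv ℂ ψ 0 (0, 1, 0)) := by
        rw [← map_sub, ← map_smul]
        congr 1
        ext <;> simp [hN]
      rw [e1, e2]
      rintro x (rfl | rfl | rfl)
      · exact Submodule.subset_span (by simp)
      · refine Submodule.mem_span_triple.2 ⟨0, 1 / 2, -(I / 2), ?_⟩
        rw [smul_smul]
        have : -(I / 2) * I = 1 / 2 := by linear_combination (-1 / 2 : ℂ) * I_mul_I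
        rw [this]
        module
      · refine Submodule.mem_span_triple.2 ⟨0, 1 / 2, I / 2, ?_⟩
        rw [smul_smul]
        have : (I / 2) * I = -(1 / 2) := by linear_combination (1 / 2 : ℂ) * I_mul_I
        rw [this]
        module)
  -- the normalized graphing function
  let BL : (Fin 3 → ℝ) →L[ℝ] (Fin 3 → ℝ) := LinearMap.toContinuousLinearMap B.toLinearMap
  let BS : (Fin 3 → ℝ) →L[ℝ] (Fin 3 → ℝ) := LinearMap.toContinuousLinearMap B.symm.toLinearMap
  let D : (ℂ × (Fin 3 → ℝ)) →L[ℝ] ℂ × (Fin 3 → ℝ) :=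
    (ContinuousLinearMap.id ℝ ℂ).prodMap BS
  have hD : ∀ x, D x = (x.1, B.symm x.2) := fun _ => rfl
  let χ : ℂ × (Fin 3 → ℝ) → (Fin 3 → ℝ) := fun x => BL (g (D x))
  have hχ : AnalyticAt ℝ χ 0 := by
    have h1 : AnalyticAt ℝ g (D 0) := by rw [map_zero]; exact hg
    exact (BL.analyticAt _).comp (h1.comp (D.analyticAt 0))
  have hχd : ∀ t : ℂ, fderiv ℝ χ 0 (t, 0) = B (fderiv ℝ g 0 (t, 0)) := by
    intro t
    have h1 : HasFDerivAt g (fderiv ℝ g 0) (D 0) := by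
      rw [map_zero]; exact hg.differentiableAt.hasFDerivAt
    have h2 : fderiv ℝ χ 0 = _ := (BL.hasFDerivAt.comp (0 : ℂ × (Fin 3 → ℝ))
      (h1.comp (0 : ℂ × (Fin 3 → ℝ)) D.hasFDerivAt)).fderiv
    rw [h2]
    change B (fderiv ℝ g 0 (t, B.symm 0)) = _
    rw [map_zero]
  obtain ⟨r, hr, hφ⟩ := exists_isNormalizedGraph hχ (by
      change B (g (D 0)) = _
      rw [map_zero, hB0]) (fun t => by
      have e1 : ((t, 0) : ℂ × (Fin 3 → ℝ)) = t.re • ((1, 0) : ℂ × (Fin 3 → ℝ)) +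
          t.im • ((I, 0) : ℂ × (Fin 3 → ℝ)) := by
        ext <;> simp
      rw [hχd, e1, map_add, map_smul, map_smul, map_add, map_smul, map_smul, hB1, hB2]
      ext k; fin_cases k <;> simp [mul_comm])
  obtain ⟨C, hC⟩ := exists_complexified_linearEquiv B
  let T : CoordSpace ≃L[ℂ] (Fin 4 → ℂ) :=
    ((ContinuousLinearEquiv.refl ℂ ℂ).prodCongr C).trans (Fin.consEquivL ℂ (fun _ : Fin 4 => ℂ))
  have hT0 : ∀ P, T P 0 = P.1 := fun _ => rfl
  have hTs : ∀ P (l : Fin 3), T P l.succ = C P.2 l := fun _ _ => rfl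
  have hre : ∀ P : CoordSpace, (fun l : Fin 3 => (T P l.succ).re) = B fun j => (P.2 j).re :=
    fun P => by simp only [hTs]; exact (hC P.2).1
  have him : ∀ P : CoordSpace, (fun l : Fin 3 => (T P l.succ).im) = B fun j => (P.2 j).im :=
    fun P => by simp only [hTs]; exact (hC P.2).2
  -- shrinking the domain
  have tre : Tendsto (fun x => ((Φ x).1, fun j => ((Φ x).2 j).re)) (𝓝 0)
      (𝓝 (0 : ℂ × (Fin 3 → ℝ))) := by
    have h1 : Tendsto (fun P : CoordSpace => (P.1, fun j => (P.2 j).re)) (𝓝 0)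
        (𝓝 (0 : ℂ × (Fin 3 → ℝ))) :=
      (by fun_prop : Continuous (fun P : CoordSpace => (P.1, fun j => (P.2 j).re))).tendsto 0
    exact h1.comp tΦ
  have tball : Tendsto (fun x => (T (Φ x) 0, fun l : Fin 3 => (T (Φ x) l.succ).re)) (𝓝 0)
      (𝓝 (0 : ℂ × (Fin 3 → ℝ))) := by
    have h1 : Tendsto (fun P : CoordSpace => (T P 0, fun l : Fin 3 => (T P l.succ).re)) (𝓝 0)
        (𝓝 (0 : ℂ × (Fin 3 → ℝ))) := by
      have hc : Continuous (fun P : CoordSpace => (T P 0, fun l : Fin 3 => (T P l.succ).re)) := by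
        have := T.continuous
        fun_prop
      have := hc.tendsto 0
      have e : ((T 0 0, fun l : Fin 3 => (T 0 l.succ).re) : ℂ × (Fin 3 → ℝ)) = 0 := by
        rw [map_zero]; rfl
      rwa [e] at this
    exact h1.comp tΦ
  obtain ⟨W, hWsub, hWo, h0W⟩ := eventually_nhds_iff.1 (((hΦ.eventually_analyticAt.and
    (tΦ.eventually hΦsymm.eventually_analyticAt)).and (hgraph.and (tre.eventually hgψ))).and
    ((tball.eventually (Metric.ball_mem_nhds _ hr)).and (hU.mem_nhds h0U)))
  let Φ' := (Φ.restrOpen W hWo).transHomeomorph T.toHomeomorph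
  have hΦ'c : ∀ x, Φ' x = T (Φ x) := fun _ => rfl
  have hΦ's : ∀ x, x ∈ Φ'.source → x ∈ Φ.source ∧ x ∈ W := fun x hx => by
    simpa [Φ'] using hx
  refine ⟨Φ', ?_, ?_, ?_, ?_, r, hr, _, hφ, ?_⟩
  · simp [Φ', hΦs, h0W]
  · rw [hΦ'c, hΦ0, map_zero]
  · intro x hx
    exact (T.analyticAt _).comp (hWsub x (hΦ's x hx).2).1.1.1
  · intro y hy
    have h1 := Φ'.map_target hy
    have h2 := (hWsub _ (hΦ's _ h1).2).1.1.2
    have h3 : Φ (Φ'.symm y) = T.symm y := by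
      have := Φ'.right_inv hy
      rw [hΦ'c] at this
      exact (T.symm_apply_eq.2 this.symm).symm
    rw [h3] at h2
    exact h2.comp (T.symm.analyticAt y)
  · intro x hx
    obtain ⟨⟨-, h1, h2⟩, h3, h4⟩ := hWsub x (hΦ's x hx).2
    refine ⟨h3, ?_⟩
    have hM : x ∈ M ↔ ρ x = 0 := by
      have := Set.ext_iff.1 hMU x
      have h4' : x ∈ U := h4
      simpa [h4'] using this
    rw [hM, h1]
    have e1 : ψ ((Φ x).1, star (Φ x).1, fun j => (((Φ x).2 j).re : ℂ)) =
        fun j => (g ((Φ x).1, fun j => ((Φ x).2 j).re) j : ℂ) := h2.symm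
    have e2 : D (T (Φ x) 0, fun l : Fin 3 => (T (Φ x) l.succ).re) =
        ((Φ x).1, fun j => ((Φ x).2 j).re) := by
      rw [hD, hre, hT0, LinearEquiv.symm_apply_apply]
    have e3 : ∀ j, normSq (T (Φ x) 0) * χ (T (Φ x) 0, fun l : Fin 3 => (T (Φ x) l.succ).re) j =
        (normSq (Φ x).1 • B (g ((Φ x).1, fun j => ((Φ x).2 j).re))) j := by
      intro j
      simp only [χ]
      rw [e2, hT0]
      rfl
    have e4 : ∀ j, (T (Φ x) (Fin.succ j)).im = B (fun j => ((Φ x).2 j).im) j := fun j =>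
      congrFun (him (Φ x)) j
    simp only [hΦ'c, e3, e4]
    rw [e1, ← funext_iff, ← map_smul, B.injective.eq_iff, funext_iff, funext_iff]
    refine forall_congr' fun j => ?_
    simp only [Pi.smul_apply, smul_eq_mul, star_def, mul_conj]
    norm_cast

end CRGeometry

theorem mainTheorem5 (M : Set (Fin 4 → ℂ)) (h0 : (0 : Fin 4 → ℂ) ∈ M)
    (hM : CRGeometry.IsGeneralClassIIIOne M) :
    ∃ Φ : OpenPartialHomeomorph (Fin 4 → ℂ) (Fin 4 → ℂ),
      (0 : Fin 4 → ℂ) ∈ Φ.source ∧ Φ 0 = 0 ∧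
      AnalyticOnNhd ℂ Φ Φ.source ∧ AnalyticOnNhd ℂ Φ.symm Φ.target ∧
      ∃ r : ℝ, 0 < r ∧ ∃ φ : Fin 3 → ℂ × (Fin 3 → ℝ) → ℝ,
        CRGeometry.IsNormalizedGraph r φ ∧
        ∀ x ∈ Φ.source,
          (Φ x 0, fun l : Fin 3 => (Φ x l.succ).re) ∈ Metric.ball (0 : ℂ × (Fin 3 → ℝ)) r ∧
          (x ∈ M ↔ ∀ j : Fin 3,
            (Φ x j.succ).im = φ j (Φ x 0, fun l : Fin 3 => (Φ x l.succ).re)) := by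
  open CRGeometry Filter Topology in
  obtain ⟨hsub, hG, hF⟩ := hM
  obtain ⟨A, U, ρ, r, ⟨hU, h0U, hρ, hs, hMU⟩, hr, hrρ, hrs, hrd⟩ :=
    exists_complexified_defining_function h0 hsub hG
  have hρ0 : ρ 0 = 0 := ((Set.ext_iff.1 hMU 0).1 ⟨h0, h0U⟩).2
  have hr0 : r 0 = 0 := by
    have h := hrρ.self_of_nhds
    rw [map_zero, star_zero, hρ0] at h
    rw [← Prod.mk_zero_zero, h]
    ext; simp
  obtain ⟨Ψ, R, hΨ, hΨ0, hΨd, hR, hRr, hRs, hRd, hRn⟩ := exists_normal_coordinates hr hr0 hrs hrd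
  have hR0 : R 0 = 0 := by
    have h := hRr.self_of_nhds
    rw [hΨ0, star_zero, Prod.mk_zero_zero, hr0] at h
    exact h
  obtain ⟨q, hq, hRq⟩ := exists_complex_graph hR hR0 hRd hRn
  obtain ⟨ψ, hψ, hψ0, hψd, hψr, hψR⟩ := exists_real_graph hRs hq hRq
  have hAΨ : AnalyticAt ℂ (fun ξ => A.symm (Ψ ξ)) 0 :=
    analyticAt_comp_zero (A.symm.analyticAt 0) hΨ hΨ0
  -- `A⁻¹ ∘ Ψ` goes from the normal coordinates to the ambient space, so the chart used below is
  -- `Θ.symm`.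
  obtain ⟨Θ, h0Θ, hΘ, hΘsymm⟩ := exists_openPartialHomeomorph hAΨ (by simp only [hΨ0, map_zero]) A.symm
    (fun v => by
      rw [fderiv_comp_zero (A.symm.analyticAt 0) hΨ hΨ0, hΨd, A.symm.fderiv]
      rfl)
  have hΘ0 : Θ 0 = 0 := by simp only [hΘ, hΨ0, map_zero]
  have hΦ0 : Θ.symm 0 = 0 := by
    have := Θ.left_inv h0Θ
    rwa [hΘ0] at this
  have hΦs : (0 : Fin 4 → ℂ) ∈ Θ.symm.source := by
    have := Θ.map_source h0Θ
    rwa [hΘ0] at this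
  have hΘan : AnalyticAt ℂ Θ.symm.symm 0 := by
    rw [OpenPartialHomeomorph.symm_symm, hΘ]
    exact hAΨ
  have tΦ := tendsto_zero_of_analyticAt hΘsymm hΦ0
  have hRρ : ∀ᶠ x in 𝓝 (0 : Fin 4 → ℂ), R (Θ.symm x, star (Θ.symm x)) = fun j => (ρ x j : ℂ) := by
    have hsrc : ∀ᶠ x in 𝓝 (0 : Fin 4 → ℂ), x ∈ Θ.symm.source := Θ.symm.open_source.mem_nhds hΦs
    filter_upwards [tΦ.eventually hRr, hrρ, hsrc] with x h1 h2 h3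
    have h4 : Ψ (Θ.symm x) = A x := by
      have := Θ.right_inv h3
      rw [hΘ] at this
      exact (A.symm_apply_eq.1 this)
    rw [h1, h4, h2]
  have hspan := span_eq_top_of_frameCondition h0 hG hF hU h0U hρ hs hMU hΦs hΦ0 hΘsymm hΘan hR hRρ
    hRd hq hRq
  refine exists_normal_form_of_graph hU h0U hMU hΦs hΦ0 hΘsymm hΘan hψ ?_ hψr ?_
  · rw [hψ0, hψd, hψd, eq_top_iff, ← hspan, Submodule.span_le]
    have hI : (2 * Complex.I : ℂ) * (1 / (2 * Complex.I)) = 1 := by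
      rw [mul_one_div, div_self (by simp)]
    have key : ∀ {S : Submodule ℂ (Fin 3 → ℂ)} {v : Fin 3 → ℂ},
        (1 / (2 * Complex.I) : ℂ) • v ∈ S → v ∈ S := fun {S v} h => by
      have := S.smul_mem (2 * Complex.I) h
      rwa [smul_smul, hI, one_smul] at this
    rintro x (rfl | rfl | rfl) <;> exact key (Submodule.subset_span (by simp))
  · filter_upwards [tΦ.eventually hψR, hRρ] with x h1 h2
    rw [← h1, h2]
    constructor
    · intro h; rw [h]; ext; simp
    · intro h
      ext j
      have := congrFun h j
      simpa using this
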